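/- Let $n\ge 1$ and $[n]=\{1,\dots,n\}$. An NTU game assigns to every nonempty $S\subseteq[n]$ a closed, nonempty, proper subset $V(S)\subset\mathbb R^S$ that is comprehensive ($x\in V(S)$, $y\le x$ imply $y\in V(S)$) and bounded in the following sense: there is $M\in\mathbb R$ such that every $x\in V(S)$ with $x_i\ge\sup V(\{i\})$ for all $i\in S$ satisfies $x_i<M$ for all $i\in S$ (if $V(\{i\})=(-\infty,0]$ for all $i$: $x\in V(S)$ and $x\ge0$ imply $x_i<M$). Put $U(S)=V(S)\times\mathbb R^{[n]\setminus S}$, $v_S=\mathbf 1_S/|S|$ and $r=\mathbf 1_{[n]}/n$. A set $\mathcal S$ of nonempty coalitions is $r$-balanced if $\sum_{S\in\mathcal S}\lambda_Sv_S=r$ for some weights $\lambda_S\ge0$; the fractional core of $(U,\{v_S\},r)$ is the set of $x\in\mathbb R^n$ that lie in no $\operatorname{int}U(S)$ and for which there are such $\mathcal S$ and $\lambda$ with $x\in U(S)$ whenever $\lambda_S>0$. The fractional core of the NTU game is defined in the same way with the condition $\sum_{S\in\mathcal S}\lambda_S\mathbf 1_S=\mathbf 1_{[n]}$ in place of $\sum_{S\in\mathcal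 S}\lambda_Sv_S=r$. Let $\tau(x)=\sup\{t: x+t\mathbf 1_{[n]}\in\bigcup_SU(S)\}$ and $F_S=\{x\in\mathbb R^n: x+\tau(x)\mathbf 1_{[n]}\in U(S)\}$. For $M>0$ let $M\Delta=\operatorname{conv}(-Me_1,\dots,-Me_n)$, with faces $\Delta_T=\operatorname{conv}\{-Me_i:i\in T\}$. Let $(V,r)$ be a pair consisting of a finite family $V=\{v_i\}$ of points of some $\mathbb R^d$ and a point $r\in\mathbb R^d$, and let $F=\{F_i\}$ be a closed cover of a compact space $X$. A map associated with $F$ and $(V,r)$ is a map $x\mapsto(\sum_i\varphi_i(x)v_i-r)/\|\sum_i\varphi_i(x)v_i-r\|$ from $X$ to the unit sphere of the direction space of the affine span of $V$, where $\{\varphi_i\}$ is a partition of unity subordinate to an open cover that contains $F$ and has the same nonempty intersections. The cover is homotopically nontrivial with respect to $(V,r)$ if some intersection $\bigcap_{i\in\mathcal S}F_i$ with $r\in\operatorname{conv}\{v_i:i\in\mathcal S\}$ is nonempty, or some associated map is not nullhomotopic. If $X$ is a sphere of the same dimension as the target, with a fixed identification with it, then $\deg F=k\in\mathbb Z$ means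 that there is no such nonempty intersection and that the associated maps (which exist) all have degree $k$. Then the following hold. 1. For all sufficiently large $M$: $\{F_S\}$ is a KKMS cover of $M\Delta$, i.e. the sets $F_S\cap M\Delta$ are closed and $\Delta_T\subseteq\bigcup_{\emptyset\ne S\subseteq T}F_S$ for every nonempty $T\subseteq[n]$; if $n\ge2$, then $\deg(F|_{\partial(M\Delta)})=1$, where $\partial(M\Delta)$ is identified with the sphere of directions by $-Me_i\mapsto e_i$ (affinely on faces) followed by radial projection from $r$; and there is an $r$-balanced $\mathcal S$ such that $\bigcap_{S\in\mathcal S}F_S$ meets $M\Delta$. 2. The triple $(U,\{v_S\},r)$ is a generalized NTU game (the sets $U(S)$ are closed, nonempty, proper and comprehensive, the coordinate sum of each $v_S$ is positive, and $0\ne r\in\operatorname{cone}\{v_S\}$). The pair $(\{v_S\},r)$ is convex, i.e. $\mathcal S$ is $r$-balanced if and only if $r\in\operatorname{conv}\{v_S:S\in\mathcal S\}$. The game is homotopically nontrivial, i.e. there is a generalized game with the same index set, the same sets $F_S$ and the same balanced sets, with a convex pair $(V',r')$, for which some continuous map $f$ from a ball $B^k$, $k\ge1$, to $\{x\in\mathbb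 R^n:\sum_ix_i=0\}$ pulls $\{F_S\}$ back to a cover whose restriction to $S^{k-1}$ is homotopically nontrivial with respect to $(V',r')$. 3. The fractional core of $(U,\{v_S\},r)$ is nonempty and equals the fractional core of the NTU game. 4. (Scarf) If the NTU game is balanced, i.e. $\bigcap_{S\in\Phi}U(S)\subseteq V([n])$ for every family $\Phi$ with weights $\lambda_S\ge0$ such that $\sum_{S\in\Phi}\lambda_S\mathbf 1_S=\mathbf 1_{[n]}$, then its core $V([n])\setminus\bigcup_S\operatorname{int}U(S)$ is nonempty. -/

import Mathlib

open Set Metric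

noncomputable section

namespace ScarfGame

/-! ### Classical cooperative games with non-transferable utility -/

/-- Nonempty coalitions of the player set `{1, …, n}`. -/
abbrev Coalition (n : ℕ) : Type := {S : Finset (Fin n) // S.Nonempty}

/-- The one-player coalition. -/
def single {n : ℕ} (i : Fin n) : Coalition n := ⟨{i}, Finset.singleton_nonempty i⟩

/-- The grand coalition. -/
def grand {n : ℕ} (hn : 0 < n) : Coalition n := ⟨Finset.univ, ⟨⟨0, hn⟩, Finset.mem_univ _⟩⟩

/-- An NTU game: `V S` is the set of payoff vectors in `ℝ^S` feasible for the coalition `S`.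
Boundedness concerns the individually rational payoff vectors, those giving each member `i` at
least as much as `i` can get alone. When `V {i} = (-∞, 0]` for all `i`, it says: there is an `M`
such that `x ∈ V S` and `x ≥ 0` imply `x i < M`. -/
structure NTUGame (n : ℕ) where
  V : (S : Coalition n) → Set (S.1 → ℝ)
  closed : ∀ S, IsClosed (V S)
  nonempty : ∀ S, (V S).Nonempty
  proper : ∀ S, V S ≠ univ
  comprehensive : ∀ S, ∀ x ∈ V S, ∀ y, y ≤ x → y ∈ V S
  bounded : ∀ S, ∃ M : ℝ, ∀ x ∈ V S,
    (∀ i : S.1, ∀ y ∈ V (single i.1), ∀ j, y j ≤ x i) → ∀ i, x i < M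

namespace NTUGame

variable {n : ℕ} (N : NTUGame n)

/-- The cylinder `U(S) = V(S) × ℝ^{[n] ∖ S}`. -/
def U (S : Coalition n) : Set (Fin n → ℝ) := {x | (fun i : S.1 => x i) ∈ N.V S}

end NTUGame

/-- `lam` is a system of balancing weights of the family `Φ` of coalitions:
`∑_{S ∈ Φ} lam_S 1_S = 1_[n]`. -/
def IsBalancingWeights {n : ℕ} (Φ : Finset (Coalition n)) (lam : Coalition n → ℝ) : Prop :=
  (∀ S ∈ Φ, 0 ≤ lam S) ∧ ∑ S ∈ Φ, lam S • (S.1 : Set (Fin n)).indicator (1 : Fin n → ℝ) = 1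

/-- Balanced families of coalitions. -/
def IsBalancedFamily {n : ℕ} (Φ : Finset (Coalition n)) : Prop :=
  ∃ lam, IsBalancingWeights Φ lam

namespace NTUGame

variable {n : ℕ} (N : NTUGame n)

/-- The core: feasible for the grand coalition and not rejected by any coalition. -/
def core (hn : 0 < n) : Set (Fin n → ℝ) := N.U (grand hn) \ ⋃ S, interior (N.U S)

/-- A balanced NTU game. -/
def IsBalanced (hn : 0 < n) : Prop :=
  ∀ Φ : Finset (Coalition n), IsBalancedFamily Φ → (⋂ S ∈ Φ, N.U S) ⊆ N.U (grand hn)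

/-- The fractional core of an NTU game. -/
def fractionalCore : Set (Fin n → ℝ) :=
  {x | (∃ Φ lam, IsBalancingWeights Φ lam ∧ ∀ S ∈ Φ, 0 < lam S → x ∈ N.U S) ∧
    ∀ S, x ∉ interior (N.U S)}

end NTUGame

/-! ### Balanced sets of firms -/

section Balanced

variable {ι : Type} [Fintype ι] {d : ℕ}

/-- `∑_{i ∈ S} lam_i v_i = r` with nonnegative weights. -/
def IsWeights (v : ι → EuclideanSpace ℝ (Fin d)) (r : EuclideanSpace ℝ (Fin d))
    (S : Finset ι) (lam : ι → ℝ) : Prop :=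
  (∀ i ∈ S, 0 ≤ lam i) ∧ ∑ i ∈ S, lam i • v i = r

/-- `S ∈ BS(V, r)`. -/
def IsRBalanced (v : ι → EuclideanSpace ℝ (Fin d)) (r : EuclideanSpace ℝ (Fin d))
    (S : Finset ι) : Prop :=
  ∃ lam, IsWeights v r S lam

/-- `S ∈ conv BS(V, r)`. -/
def IsConvRBalanced (v : ι → EuclideanSpace ℝ (Fin d)) (r : EuclideanSpace ℝ (Fin d))
    (S : Finset ι) : Prop :=
  r ∈ convexHull ℝ (v '' S)

/-- A pair `(V, r)` is convex if `BS(V, r) = conv BS(V, r)`. -/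
def IsConvexPair (v : ι → EuclideanSpace ℝ (Fin d)) (r : EuclideanSpace ℝ (Fin d)) : Prop :=
  ∀ S : Finset ι, IsRBalanced v r S ↔ IsConvRBalanced v r S

end Balanced

/-! ### Homotopy invariants of covers -/

section Covers

variable {ι : Type} [Fintype ι] {d : ℕ} {X : Type} [TopologicalSpace X]

/-- The unit sphere of the direction space of the affine span of `V`, i.e. the target of the maps
associated with covers (as a sphere of dimension `dim aff(V) - 1`, centred at the origin). -/
def dirSphere (v : ι → EuclideanSpace ℝ (Fin d)) : Set (EuclideanSpace ℝ (Fin d)) :=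
  {y | y ∈ vectorSpan ℝ (range v) ∧ ‖y‖ = 1}

/-- There is a convex `r`-balanced set `S` with `⋂_{i ∈ S} F i ≠ ∅`. -/
def HasBalancedIntersection (F : ι → Set X) (v : ι → EuclideanSpace ℝ (Fin d))
    (r : EuclideanSpace ℝ (Fin d)) : Prop :=
  ∃ S : Finset ι, IsConvRBalanced v r S ∧ (⋂ i ∈ S, F i).Nonempty

/-- `g` is a map `x ↦ (∑ φ_i(x) v_i - r) / ‖∑ φ_i(x) v_i - r‖` associated with the closed cover
`F`, where `φ` is a partition of unity subordinate to an open cover `W` that contains `F` and has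
the same pattern of nonempty intersections as `F`. As `g` takes values in the unit sphere, the
denominator vanishes nowhere. -/
def IsCoverMap (F : ι → Set X) (v : ι → EuclideanSpace ℝ (Fin d))
    (r : EuclideanSpace ℝ (Fin d)) (g : C(X, dirSphere v)) : Prop :=
  ∃ (W : ι → Set X) (φ : PartitionOfUnity ι X),
    (∀ i, IsOpen (W i)) ∧ (∀ i, F i ⊆ W i) ∧
    (∀ S : Finset ι, (⋂ i ∈ S, F i).Nonempty ↔ (⋂ i ∈ S, W i).Nonempty) ∧
    φ.IsSubordinate W ∧
    ∀ x, (g x : EuclideanSpace ℝ (Fin d)) =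
      ‖∑ i, φ i x • v i - r‖⁻¹ • (∑ i, φ i x • v i - r)

/-- `[F_{(V,r)}] ≠ 0` for a closed cover `F` of a compact space. -/
def IsNontrivialCover (F : ι → Set X) (v : ι → EuclideanSpace ℝ (Fin d))
    (r : EuclideanSpace ℝ (Fin d)) : Prop :=
  HasBalancedIntersection F v r ∨
    ∃ g : C(X, dirSphere v), IsCoverMap F v r g ∧ ¬ g.Nullhomotopic

/-- The map induced on the `m`-th integral singular homology. -/
def homologyMap {Y : Type} [TopologicalSpace Y] (m : ℕ) (f : C(X, Y)) :=
  ((((AlgebraicTopology.singularHomologyFunctor (ModuleCat.{0} ℤ) m).obj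
    (ModuleCat.of ℤ ℤ)).map (TopCat.ofHom f)).hom)

/-- The degree of `f : X → Y`, where `X` and `Y` are `m`-spheres oriented compatibly with the
homeomorphism `e : X → Y`, is `k`: one has `f_* = k e_*` on the reduced homology
`ker (H_m(X) → H_m(point))`. -/
def HasDegree {Y : Type} [TopologicalSpace Y] (e f : C(X, Y)) (m : ℕ) (k : ℤ) : Prop :=
  ∀ z, homologyMap m (ContinuousMap.const X ()) z = 0 →
    homologyMap m f z = k • homologyMap m e z

/-- `deg F_{(V,r)} = k` for a closed cover `F` of an `m`-sphere `X` that is identified with the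
sphere of directions by `e`: there is no balanced intersection (the degree is not `∞`), and every
map associated with `F` (of which there is at least one) has degree `k`. -/
def HasCoverDegree (F : ι → Set X) (v : ι → EuclideanSpace ℝ (Fin d))
    (r : EuclideanSpace ℝ (Fin d)) (e : C(X, dirSphere v)) (m : ℕ) (k : ℤ) : Prop :=
  ¬ HasBalancedIntersection F v r ∧ (∃ g, IsCoverMap F v r g) ∧
    ∀ g, IsCoverMap F v r g → HasDegree e g m k

end Covers

/-! ### Generalized games -/

/-- A generalized NTU cooperative game with external relations `(U, V, r)`: firms `v i ∈ ℝ^d`,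
allocations in `ℝ^n`, resource vector `r`. -/
structure GenGame (ι : Type) [Fintype ι] (n d : ℕ) where
  U : ι → Set (Fin n → ℝ)
  v : ι → EuclideanSpace ℝ (Fin d)
  r : EuclideanSpace ℝ (Fin d)
  closed : ∀ i, IsClosed (U i)
  nonempty : ∀ i, (U i).Nonempty
  proper : ∀ i, U i ≠ univ
  comprehensive : ∀ i, ∀ x ∈ U i, ∀ y, y ≤ x → y ∈ U i
  firm_pos : ∀ i, 0 < ∑ j, v i j
  r_ne_zero : r ≠ 0
  r_mem_cone : ∃ lam : ι → ℝ, (∀ i, 0 ≤ lam i) ∧ ∑ i, lam i • v i = r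

namespace GenGame

variable {ι : Type} [Fintype ι] {n d : ℕ} (G : GenGame ι n d)

/-- The fractional core. -/
def fractionalCore : Set (Fin n → ℝ) :=
  {x | (∃ S lam, IsWeights G.v G.r S lam ∧ ∀ i ∈ S, 0 < lam i → x ∈ G.U i) ∧
    ∀ i, x ∉ interior (G.U i)}

/-- `τ(x) = sup {t | x + t 1 ∈ ⋃ U_i}`. -/
def tau (x : Fin n → ℝ) : ℝ := sSup {t : ℝ | x + t • 1 ∈ ⋃ i, G.U i}

/-- The induced cover `F(U_i) = {x | x + τ(x) 1 ∈ U_i}`. -/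
def cover (i : ι) : Set (Fin n → ℝ) := {x | x + G.tau x • 1 ∈ G.U i}

/-- Equivalence of games: same induced cover and corresponding balanced sets. -/
def Equivalent {d' : ℕ} (G' : GenGame ι n d') : Prop :=
  (∀ i, G.cover i = G'.cover i) ∧
    ∀ S : Finset ι, IsRBalanced G.v G.r S ↔ IsRBalanced G'.v G'.r S

/-- The induced cover of the hyperplane `H₀ = {x | ∑ x_i = 0}` is homotopically nontrivial with
respect to `(V, r)`: some map `f : B^k → H₀`, `k ≥ 1`, pulls it back to a cover of the ball whose
restriction to the boundary sphere is homotopically nontrivial. -/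
def CoverNontrivial : Prop :=
  ∃ (k : ℕ) (f : C(closedBall (0 : EuclideanSpace ℝ (Fin k)) 1,
      {x : Fin n → ℝ // ∑ i, x i = 0})), 1 ≤ k ∧
    IsNontrivialCover
      (fun i => {x : sphere (0 : EuclideanSpace ℝ (Fin k)) 1 |
        (f ⟨x, sphere_subset_closedBall x.2⟩ : Fin n → ℝ) ∈ G.cover i}) G.v G.r

/-- Homotopical nontriviality of a game. -/
def HomotopicallyNontrivial : Prop :=
  ∃ (d' : ℕ) (G' : GenGame ι n d'), G.Equivalent G' ∧ IsConvexPair G'.v G'.r ∧ G'.CoverNontrivial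

end GenGame

/-! ### The generalized game attached to an NTU game -/

/-- The firm `v_S = 1_S / |S|`. -/
def firm {n : ℕ} (S : Coalition n) : EuclideanSpace ℝ (Fin n) :=
  WithLp.toLp 2 fun i => if i ∈ S.1 then (S.1.card : ℝ)⁻¹ else 0

/-- The barycenter `r = 1_[n] / n`. -/
def bary (n : ℕ) : EuclideanSpace ℝ (Fin n) := WithLp.toLp 2 fun _ => (n : ℝ)⁻¹

lemma firm_grand {n : ℕ} (hn : 0 < n) : firm (grand hn) = bary n := by
  ext i
  simp [firm, bary, grand]

lemma firm_single {n : ℕ} (i : Fin n) : firm (single i) = EuclideanSpace.single i (1 : ℝ) := by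
  ext j
  simp [firm, single]

/-- The generalized game `(U, {1_S / |S|}, 1_[n] / n)` attached to an NTU game. -/
def NTUGame.toGen {n : ℕ} (hn : 0 < n) (N : NTUGame n) : GenGame (Coalition n) n n where
  U := N.U
  v := firm
  r := bary n
  closed S := (N.closed S).preimage (by fun_prop)
  nonempty S := by
    obtain ⟨y, hy⟩ := N.nonempty S
    refine ⟨fun i => if h : i ∈ S.1 then y ⟨i, h⟩ else 0, ?_⟩
    simpa [NTUGame.U] using hy
  proper S h := by
    apply N.proper S
    refine eq_univ_of_forall fun y => ?_
    have : (fun i => if h : i ∈ S.1 then y ⟨i, h⟩ else 0) ∈ N.U S := by rw [h]; trivial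
    simpa [NTUGame.U] using this
  comprehensive S x hx y hy := N.comprehensive S _ hx _ fun i => hy i
  firm_pos S := by
    have : 0 < S.1.card := Finset.card_pos.2 S.2
    have h : ∑ j, firm S j = 1 := by
      simp [firm, Finset.sum_ite_mem]
      field_simp
    rw [h]; exact one_pos
  r_ne_zero h := by
    have := congrArg (fun x : EuclideanSpace ℝ (Fin n) => x ⟨0, hn⟩) h
    simp [bary] at this
    omega
  r_mem_cone := by
    classical
    refine ⟨Pi.single (grand hn) 1, fun i => ?_, ?_⟩
    · by_cases h : i = grand hn
      · subst h; simp
      · simp [h]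
    · simp [Pi.single_apply, firm_grand]

/-! ### The large simplex -/

/-- The face `conv {-M e_i | i ∈ T}` of the scaled simplex. -/
def face {n : ℕ} (M : ℝ) (T : Finset (Fin n)) : Set (Fin n → ℝ) :=
  convexHull ℝ ((fun i => Pi.single i (-M)) '' (T : Set (Fin n)))

/-- The scaled simplex `MΔ = conv {-M e_1, …, -M e_n}`. -/
def simplex (n : ℕ) (M : ℝ) : Set (Fin n → ℝ) := face M Finset.univ

/-- The boundary of the scaled simplex: the union of its proper faces. -/
def boundary (n : ℕ) (M : ℝ) : Set (Fin n → ℝ) :=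
  ⋃ T : {T : Finset (Fin n) // T ≠ Finset.univ}, face M T.1

/-- A family `F`, restricted to the scaled simplex, is a KKMS cover of it: its members are closed
there and every face `Δ_T` is covered by the `F_S` with `S ⊆ T`. -/
def IsKKMSCover {n : ℕ} (M : ℝ) (F : Coalition n → Set (Fin n → ℝ)) : Prop :=
  (∀ S, IsClosed (F S ∩ simplex n M)) ∧
    ∀ T : Coalition n, face M T.1 ⊆ ⋃ S : {S : Coalition n // S.1 ⊆ T.1}, F S.1

/-- The point of the standard simplex with the barycentric coordinates of `p`. -/
def bar {n : ℕ} (M : ℝ) (p : Fin n → ℝ) : EuclideanSpace ℝ (Fin n) := WithLp.toLp 2 (-M⁻¹ • p)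

lemma bar_mem {n : ℕ} {M : ℝ} (hM : 0 < M) {p : Fin n → ℝ} (hp : p ∈ boundary n M) :
    bar M p - bary n ≠ 0 ∧ bar M p - bary n ∈ vectorSpan ℝ (range (firm (n := n))) := by
  simp only [boundary, mem_iUnion] at hp
  obtain ⟨⟨T, hT⟩, hp⟩ := hp
  obtain ⟨j, hj⟩ : ∃ j, j ∉ T := by
    by_contra! h
    exact hT (Finset.eq_univ_of_forall h)
  have hn : 0 < n := j.pos
  constructor
  · have h0 : p j = 0 := by
      have : face M T ⊆ {q : Fin n → ℝ | q j = 0} := by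
        refine convexHull_min ?_ ?_
        · rintro _ ⟨i, hi, rfl⟩
          have : j ≠ i := fun h => hj (h ▸ hi)
          simp [this]
        · exact (convex_singleton (0 : ℝ)).linear_preimage (LinearMap.proj j : (Fin n → ℝ) →ₗ[ℝ] ℝ)
      exact this hp
    intro h
    have := congrArg (fun x : EuclideanSpace ℝ (Fin n) => x j) h
    simp [bary, bar, h0] at this
    omega
  · rw [← vsub_eq_sub]
    have hb : bary n ∈ affineSpan ℝ (range (firm (n := n))) :=
      subset_affineSpan _ _ ⟨grand hn, firm_grand hn⟩
    refine vsub_mem_vectorSpan_of_mem_affineSpan_of_mem_affineSpan ?_ hb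
    refine convexHull_subset_affineSpan _ ?_
    let L : (Fin n → ℝ) →ₗ[ℝ] EuclideanSpace ℝ (Fin n) :=
      (-M⁻¹) • (WithLp.linearEquiv 2 ℝ (Fin n → ℝ)).symm.toLinearMap
    have : face M T ⊆ L ⁻¹' convexHull ℝ (range (firm (n := n))) := by
      refine convexHull_min ?_ ((convex_convexHull ℝ _).linear_preimage L)
      rintro _ ⟨i, -, rfl⟩
      refine subset_convexHull _ _ ⟨single i, ?_⟩
      rw [firm_single]
      ext k
      by_cases h : k = i
      · subst h; simp [L, hM.ne']
      · simp [L, h]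
    exact this hp

/-- The identification of the boundary of the scaled simplex with the sphere of directions: the
vertex `-M e_i` corresponds to `e_i = v_{i}`, and the boundary of the standard simplex is projected
radially from its barycenter. -/
def radial (n : ℕ) (M : ℝ) (hM : 0 < M) : C(boundary n M, dirSphere (firm (n := n))) where
  toFun p := ⟨‖bar M p.1 - bary n‖⁻¹ • (bar M p.1 - bary n),
    Submodule.smul_mem _ _ (bar_mem hM p.2).2, by
      have := norm_ne_zero_iff.2 (bar_mem hM p.2).1
      rw [norm_smul, norm_inv, norm_norm, inv_mul_cancel₀ this]⟩
  continuous_toFun := by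
    have h : Continuous fun p : boundary n M => bar M p.1 - bary n := by
      unfold bar; fun_prop
    refine Continuous.subtype_mk ?_ _
    exact (h.norm.inv₀ fun p => norm_ne_zero_iff.2 (bar_mem hM p.2).1).smul h

end ScarfGame

end

/-! ### Scarf's combinatorial lemma -/

section Scarf

variable {Y I L : Type*} [LinearOrder L]

/-- `R` is dominant for the family `u` of utility functions if no element of `Y` is strictly better
than the worst elements of `R` with respect to all utilities. -/
def IsDominant (u : I → Y → L) (R : Finset Y) : Prop :=
  ∀ x, ∃ i, ∀ y ∈ R, u i x ≤ u i y

lemma IsDominant.mono {u : I → Y → L} {R T : Finset Y} (hR : IsDominant u R) (h : T ⊆ R) :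
    IsDominant u T := fun x =>
  let ⟨i, hi⟩ := hR x
  ⟨i, fun y hy => hi y (h hy)⟩

variable [DecidableEq Y] [Fintype I] [DecidableEq I]

/-- A set of `n` elements without all `n` colours has an even number of subsets of size `n - 1`
carrying all colours but `i₀`. -/
lemma even_card_erase_image_eq (c : Y → I) (i₀ : I) (R : Finset Y) (hR : R.card = Fintype.card I)
    (hc : R.image c ≠ Finset.univ) :
    Even (R.filter fun y => (R.erase y).image c = Finset.univ.erase i₀).card := by
  rcases (R.filter fun y => (R.erase y).image c = Finset.univ.erase i₀).eq_empty_or_nonempty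
    with h | ⟨a, ha⟩
  · simp [h]
  simp only [Finset.mem_filter] at ha
  obtain ⟨haR, ha⟩ := ha
  have hmem : ∀ i, i ≠ i₀ → ∃ z ∈ R, z ≠ a ∧ c z = i := by
    intro i hi
    have : i ∈ (R.erase a).image c := by rw [ha]; simp [hi]
    simp only [Finset.mem_image, Finset.mem_erase] at this
    obtain ⟨z, ⟨h1, h2⟩, h3⟩ := this
    exact ⟨z, h2, h1, h3⟩
  have hca : c a ≠ i₀ := by
    intro h
    apply hc
    refine Finset.eq_univ_of_forall fun i => ?_
    by_cases hi : i = i₀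
    · exact Finset.mem_image.2 ⟨a, haR, by rw [h, hi]⟩
    · obtain ⟨z, hz, -, hz'⟩ := hmem i hi
      exact Finset.mem_image.2 ⟨z, hz, hz'⟩
  have hinj : Set.InjOn c (R.erase a) := by
    apply Finset.card_image_iff.1
    rw [ha, Finset.card_erase_of_mem haR, Finset.card_erase_of_mem (Finset.mem_univ _), hR,
      Finset.card_univ]
  obtain ⟨b, hbR, hba, hcb⟩ := hmem (c a) hca
  have hne : ∀ z ∈ R, c z ≠ i₀ := by
    intro z hz
    by_cases hza : z = a
    · rwa [hza]
    · have : c z ∈ (R.erase a).image c := Finset.mem_image_of_mem _ (by simp [hza, hz])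
      rw [ha] at this
      exact (Finset.mem_erase.1 this).1
  suffices h : (R.filter fun y => (R.erase y).image c = Finset.univ.erase i₀) = {a, b} by
    rw [h, Finset.card_pair hba.symm]; exact even_two
  ext y
  simp only [Finset.mem_filter, Finset.mem_insert, Finset.mem_singleton]
  constructor
  · rintro ⟨hy, hyc⟩
    by_cases hya : y = a
    · exact Or.inl hya
    right
    have : c y ∈ (R.erase y).image c := by rw [hyc]; simp [hne y hy]
    obtain ⟨z, hz, hzy⟩ := Finset.mem_image.1 this
    obtain ⟨hz1, hz2⟩ := Finset.mem_erase.1 hz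
    have hza : z = a := by
      by_contra hza
      exact hz1 (hinj (by simp [hza, hz2]) (by simp [hya, hy]) hzy)
    subst hza
    exact hinj (by simp [hya, hy]) (by simp [hba, hbR]) (by rw [hcb, hzy])
  · rintro (rfl | rfl)
    · exact ⟨haR, ha⟩
    · refine ⟨hbR, ?_⟩
      ext i
      simp only [Finset.mem_image, Finset.mem_erase, Finset.mem_univ, and_true]
      constructor
      · rintro ⟨z, ⟨-, hz⟩, rfl⟩
        exact hne z hz
      · intro hi
        by_cases hia : i = c a
        · exact ⟨a, ⟨hba.symm, haR⟩, hia.symm⟩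
        · obtain ⟨z, hz, hza, hzi⟩ := hmem i hi
          refine ⟨z, ⟨?_, hz⟩, hzi⟩
          rintro rfl
          exact hia (by rw [← hzi, hcb])

variable [Fintype Y]

/-- A dominant set of size `n - 1` that is not on the boundary extends in exactly two ways to a
dominant set of size `n`. -/
lemma card_dominant_insert_eq_two (u : I → Y → L) (hu : ∀ i, Function.Injective (u i))
    (T : Finset Y) (hT : IsDominant u T) (hcard : T.card + 1 = Fintype.card I)
    (m : I → Y) (hmT : ∀ i, m i ∈ T) (hm : ∀ i, ∀ y ∈ T, u i (m i) ≤ u i y)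
    (hM : ∀ j, ∃ x, ∀ i, i ≠ j → u i (m i) < u i x) :
    ∃ p q, p ≠ q ∧ ∀ x, (x ∉ T ∧ IsDominant u (insert x T)) ↔ x = p ∨ x = q := by
  have hsurj : ∀ t ∈ T, ∃ i, m i = t := by
    intro t ht
    obtain ⟨i, hi⟩ := hT t
    exact ⟨i, hu i (le_antisymm (hm i t ht) (hi _ (hmT i)))⟩
  obtain ⟨a, -, b, -, hab, hmab⟩ := Finset.exists_ne_map_eq_of_card_lt_of_maps_to
    (s := Finset.univ) (t := T) (f := m) (by rw [Finset.card_univ]; omega) (fun i _ => hmT i)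
  have hcov : ∀ j, j = a ∨ j = b → ∀ t ∈ T, ∃ i, i ≠ j ∧ m i = t := by
    intro j hj t ht
    obtain ⟨i, hi⟩ := hsurj t ht
    by_cases hij : i = j
    · rcases hj with rfl | rfl
      · exact ⟨b, hab.symm, by rw [← hmab, ← hij, hi]⟩
      · exact ⟨a, hab, by rw [hmab, ← hij, hi]⟩
    · exact ⟨i, hij, hi⟩
  have hbij : ∀ j, (∀ t ∈ T, ∃ i, i ≠ j ∧ m i = t) → ∀ i i', i ≠ j → i' ≠ j → m i = m i' →
      i = i' := by
    intro j hj
    have : Set.InjOn m (Finset.univ.erase j : Finset I) := by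
      apply Finset.card_image_iff.1
      have h : (Finset.univ.erase j).image m = T := by
        ext t
        simp only [Finset.mem_image, Finset.mem_erase, Finset.mem_univ, and_true]
        exact ⟨fun ⟨i, _, hi⟩ => hi ▸ hmT i, hj t⟩
      rw [h, Finset.card_erase_of_mem (Finset.mem_univ _), Finset.card_univ]
      omega
    intro i i' hi hi' h
    exact this (by simpa using hi) (by simpa using hi') h
  have hex : ∀ j, j = a ∨ j = b → ∃ x, (x ∉ T ∧ IsDominant u (insert x T)) ∧
      ∀ i, i ≠ j → u i (m i) < u i x := by
    intro j hj
    obtain ⟨x₀, hx₀⟩ := hM j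
    obtain ⟨x, hx, hmax⟩ := Finset.exists_max_image
      (Finset.univ.filter fun x => ∀ i, i ≠ j → u i (m i) < u i x) (u j) ⟨x₀, by simpa using hx₀⟩
    simp only [Finset.mem_filter, Finset.mem_univ, true_and] at hx hmax
    refine ⟨x, ⟨fun hxT => ?_, fun y => ?_⟩, hx⟩
    · obtain ⟨i, hij, hi⟩ := hcov j hj x hxT
      exact (hx i hij).ne (by rw [hi])
    · by_cases hy : ∀ i, i ≠ j → u i (m i) < u i y
      · refine ⟨j, fun z hz => ?_⟩
        rcases Finset.mem_insert.1 hz with rfl | hz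
        · exact hmax y hy
        · obtain ⟨i, hi⟩ := hT y
          by_cases hij : i = j
          · exact hij ▸ hi z hz
          · exact absurd (hi _ (hmT i)) (not_le.2 (hy i hij))
      · push Not at hy
        obtain ⟨i, hij, hi⟩ := hy
        refine ⟨i, fun z hz => ?_⟩
        rcases Finset.mem_insert.1 hz with rfl | hz
        · exact hi.trans (hx i hij).le
        · exact hi.trans (hm i z hz)
  have huniq : ∀ j x x', IsDominant u (insert x T) → IsDominant u (insert x' T) →
      (∀ i, i ≠ j → u i (m i) < u i x) → (∀ i, i ≠ j → u i (m i) < u i x') → x = x' := by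
    have key : ∀ j x x', IsDominant u (insert x T) →
        (∀ i, i ≠ j → u i (m i) < u i x') → u j x' ≤ u j x := by
      intro j x x' hd h
      obtain ⟨i, hi⟩ := hd x'
      by_cases hij : i = j
      · exact hij ▸ hi x (Finset.mem_insert_self _ _)
      · exact absurd (hi _ (Finset.mem_insert_of_mem (hmT i))) (not_le.2 (h i hij))
    exact fun j x x' h1 h2 h3 h4 => hu j (le_antisymm (key j x' x h2 h3) (key j x x' h1 h4))
  have hall : ∀ x, x ∉ T → IsDominant u (insert x T) →
      ∃ j, (j = a ∨ j = b) ∧ ∀ i, i ≠ j → u i (m i) < u i x := by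
    intro x hxT hx
    obtain ⟨j, hj⟩ := hx x
    have h1 : ∀ t ∈ T, ∃ i, i ≠ j ∧ m i = t ∧ u i (m i) < u i x := by
      intro t ht
      obtain ⟨i, hi⟩ := hx t
      have hmi : m i = t :=
        hu i (le_antisymm (hm i t ht) (hi _ (Finset.mem_insert_of_mem (hmT i))))
      have hxt : t ≠ x := fun h => hxT (h ▸ ht)
      refine ⟨i, ?_, hmi, ?_⟩
      · rintro rfl
        exact hxt (hu i (le_antisymm (hi x (Finset.mem_insert_self _ _))
          (hj t (Finset.mem_insert_of_mem ht))))
      · rw [hmi]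
        exact lt_of_le_of_ne (hi x (Finset.mem_insert_self _ _)) fun h => hxt (hu i h)
    have h2 := hbij j fun t ht => let ⟨i, hi, hi', _⟩ := h1 t ht; ⟨i, hi, hi'⟩
    refine ⟨j, ?_, fun i hij => ?_⟩
    · by_contra! h
      exact hab (h2 a b h.1.symm h.2.symm hmab)
    · obtain ⟨i', hi', hmi, hlt⟩ := h1 (m i) (hmT i)
      rwa [h2 i i' hij hi' hmi.symm]
  obtain ⟨p, hp, hp'⟩ := hex a (Or.inl rfl)
  obtain ⟨q, hq, hq'⟩ := hex b (Or.inr rfl)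
  refine ⟨p, q, ?_, fun x => ⟨?_, ?_⟩⟩
  · rintro rfl
    obtain ⟨i, hi⟩ := hT p
    refine absurd (hi _ (hmT i)) (not_le.2 ?_)
    by_cases hia : i = a
    · exact hq' i (hia ▸ hab)
    · exact hp' i hia
  · rintro ⟨hxT, hx⟩
    obtain ⟨j, rfl | rfl, hj⟩ := hall x hxT hx
    · exact Or.inl (huniq _ x p hx hp.2 hj hp')
    · exact Or.inr (huniq _ x q hx hq.2 hj hq')
  · rintro (rfl | rfl)
    exacts [hp, hq]

/-- Scarf's lemma: if the slack element `s i` is the least one for the utility `u i` and exceeds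
all non-slack elements for the other utilities, then for every colouring `c` with `c (s i) = i`
there is a dominant set of `n` elements carrying all `n` colours. -/
theorem exists_dominant_image_eq_univ [Nonempty I] (u : I → Y → L)
    (hu : ∀ i, Function.Injective (u i)) (s : I → Y) (c : Y → I) (hcs : ∀ i, c (s i) = i)
    (hmin : ∀ i y, u i (s i) ≤ u i y)
    (hmax : ∀ i j y, j ≠ i → y ∉ range s → u i y < u i (s j)) (hX : ∃ y, y ∉ range s) :
    ∃ R, IsDominant u R ∧ R.image c = Finset.univ := by
  classical
  have hs : Function.Injective s := fun i j h => by rw [← hcs i, ← hcs j, h]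
  by_contra! hno
  let i₀ : I := Classical.arbitrary I
  let rooms : Finset (Finset Y) := Finset.univ.filter fun R =>
    IsDominant u R ∧ R.card = Fintype.card I
  let doors : Finset (Finset Y) := Finset.univ.filter fun T =>
    IsDominant u T ∧ T.card + 1 = Fintype.card I ∧ T.image c = Finset.univ.erase i₀
  have hcount := Finset.sum_card_bipartiteAbove_eq_sum_card_bipartiteBelow
    (s := doors) (t := rooms) (fun T R : Finset Y => T ⊆ R)
  have heven : Even (∑ R ∈ rooms, (doors.bipartiteBelow (fun T R : Finset Y => T ⊆ R) R).card) := by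
    refine Finset.even_sum _ fun R hR => ?_
    obtain ⟨hRd, hRc⟩ := (Finset.mem_filter.1 hR).2
    have := even_card_erase_image_eq c i₀ R hRc (hno R hRd)
    rw [← Finset.card_image_of_injOn (f := fun y => R.erase y)] at this
    · refine (congrArg (fun A : Finset (Finset Y) => Even A.card) ?_).mpr this
      ext T
      simp only [Finset.mem_bipartiteBelow, doors, Finset.mem_filter, Finset.mem_univ, true_and,
        Finset.mem_image]
      constructor
      · rintro ⟨⟨-, hTc, hT⟩, hTR⟩
        obtain ⟨y, hy⟩ : ∃ y, R \ T = {y} := Finset.card_eq_one.1 (by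
          rw [Finset.card_sdiff_of_subset hTR]; omega)
        have hyR : y ∈ R := (Finset.mem_sdiff.1 (hy ▸ Finset.mem_singleton_self y)).1
        have hTy : R.erase y = T := by
          rw [Finset.erase_eq, ← hy, Finset.sdiff_sdiff_eq_self hTR]
        exact ⟨y, ⟨hyR, by rw [hTy, hT]⟩, hTy⟩
      · rintro ⟨y, ⟨hy, hyc⟩, rfl⟩
        refine ⟨⟨hRd.mono (Finset.erase_subset _ _), ?_, hyc⟩, Finset.erase_subset _ _⟩
        rw [Finset.card_erase_add_one hy, hRc]
    · intro y hy z hz h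
      have hyR := (Finset.mem_filter.1 hy).1
      by_contra hne
      have : y ∈ R.erase z := Finset.mem_erase.2 ⟨hne, hyR⟩
      exact Finset.notMem_erase y R ((Finset.ext_iff.1 h y).2 this)
  have hrooms : ∀ T ∈ doors, (rooms.bipartiteAbove (fun T R : Finset Y => T ⊆ R) T) =
      (Finset.univ.filter fun x => x ∉ T ∧ IsDominant u (insert x T)).image
        fun x => insert x T := by
    intro T hT
    obtain ⟨-, hTc, -⟩ := (Finset.mem_filter.1 hT).2
    ext R
    simp only [Finset.mem_bipartiteAbove, rooms, Finset.mem_filter, Finset.mem_univ, true_and,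
      Finset.mem_image]
    constructor
    · rintro ⟨⟨hR, hRc⟩, hTR⟩
      obtain ⟨y, hy⟩ : ∃ y, R \ T = {y} := Finset.card_eq_one.1 (by
        rw [Finset.card_sdiff_of_subset hTR]; omega)
      have hyR := Finset.mem_sdiff.1 (hy ▸ Finset.mem_singleton_self y)
      have : insert y T = R := by
        rw [Finset.insert_eq, ← hy, Finset.sdiff_union_of_subset hTR]
      exact ⟨y, ⟨hyR.2, this ▸ hR⟩, this⟩
    · rintro ⟨x, ⟨hxT, hx⟩, rfl⟩
      exact ⟨⟨hx, by rw [Finset.card_insert_of_notMem hxT, hTc]⟩, Finset.subset_insert _ _⟩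
  have hinj : ∀ T : Finset Y, Set.InjOn (fun x => insert x T)
      (Finset.univ.filter fun x => x ∉ T ∧ IsDominant u (insert x T) : Finset Y) := by
    intro T x hx y hy h
    simp only [Finset.coe_filter, Finset.mem_univ, true_and, Set.mem_ofPred_eq] at hx hy
    have : x ∈ insert y T := (Finset.ext_iff.1 h x).1 (Finset.mem_insert_self x T)
    exact (Finset.mem_insert.1 this).resolve_right hx.1
  let T₀ : Finset Y := (Finset.univ.erase i₀).image s
  have hT₀c : T₀.image c = Finset.univ.erase i₀ := by
    rw [Finset.image_image]
    have : c ∘ s = id := funext hcs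
    rw [this, Finset.image_id]
  have hT₀ : T₀ ∈ doors := by
    refine Finset.mem_filter.2 ⟨Finset.mem_univ _, fun x => ?_, ?_, hT₀c⟩
    · by_cases hx : x ∈ range s
      · obtain ⟨j, rfl⟩ := hx
        exact ⟨j, fun y _ => hmin j y⟩
      · refine ⟨i₀, fun y hy => ?_⟩
        obtain ⟨j, hj, rfl⟩ := Finset.mem_image.1 hy
        exact (hmax i₀ j x (Finset.mem_erase.1 hj).1 hx).le
    · rw [Finset.card_image_of_injective _ hs, Finset.card_erase_add_one (Finset.mem_univ _),
        Finset.card_univ]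
  have hodd : (rooms.bipartiteAbove (fun T R : Finset Y => T ⊆ R) T₀).card = 1 := by
    rw [hrooms T₀ hT₀, Finset.card_image_of_injOn (hinj T₀), Finset.card_eq_one]
    obtain ⟨x₀, hx₀⟩ := hX
    obtain ⟨p, hp, hpmax⟩ := Finset.exists_max_image
      (Finset.univ.filter fun x => x ∉ range s) (u i₀) ⟨x₀, by simpa using hx₀⟩
    simp only [Finset.mem_filter, Finset.mem_univ, true_and] at hp hpmax
    refine ⟨p, ?_⟩
    ext x
    simp only [Finset.mem_filter, Finset.mem_univ, true_and, Finset.mem_singleton]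
    have hsT : ∀ i, i ≠ i₀ → s i ∈ T₀ := fun i hi => Finset.mem_image_of_mem _ (by simp [hi])
    have hslack : ∀ z i, z ∉ range s → ¬ u i z ≤ u i (s i) := fun z i hz h =>
      hz ⟨i, hu i (le_antisymm (hmin i z) h)⟩
    constructor
    · rintro ⟨hxT, hx⟩
      have hxs : x ∉ range s := by
        rintro ⟨j, rfl⟩
        have hj : j = i₀ := by
          by_contra hj
          exact hxT (hsT j hj)
        subst hj
        obtain ⟨i, hi⟩ := hx p
        refine hslack p i hp (hi (s i) ?_)
        by_cases hii : i = i₀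
        · rw [hii]; exact Finset.mem_insert_self _ _
        · exact Finset.mem_insert_of_mem (hsT i hii)
      obtain ⟨i, hi⟩ := hx p
      have hii : i = i₀ := by
        by_contra hii
        exact hslack p i hp (hi (s i) (Finset.mem_insert_of_mem (hsT i hii)))
      subst hii
      exact hu _ (le_antisymm (hpmax x hxs) (hi x (Finset.mem_insert_self _ _)))
    · rintro rfl
      refine ⟨fun h => ?_, fun y => ?_⟩
      · obtain ⟨j, -, hj⟩ := Finset.mem_image.1 h
        exact hp ⟨j, hj⟩
      · by_cases hy : y ∈ range s
        · obtain ⟨j, rfl⟩ := hy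
          exact ⟨j, fun z _ => hmin j z⟩
        · refine ⟨i₀, fun z hz => ?_⟩
          rcases Finset.mem_insert.1 hz with rfl | hz
          · exact hpmax y hy
          · obtain ⟨j, hj, rfl⟩ := Finset.mem_image.1 hz
            exact (hmax i₀ j y (Finset.mem_erase.1 hj).1 hy).le
  have htwo : ∀ T ∈ doors.erase T₀,
      (rooms.bipartiteAbove (fun T R : Finset Y => T ⊆ R) T).card = 2 := by
    intro T hT
    obtain ⟨hne, hTd⟩ := Finset.mem_erase.1 hT
    rw [hrooms T hTd, Finset.card_image_of_injOn (hinj T)]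
    obtain ⟨hTdom, hTc, hTim⟩ := (Finset.mem_filter.1 hTd).2
    obtain ⟨y, hyT, hy⟩ : ∃ y ∈ T, y ∉ range s := by
      by_contra! h
      apply hne
      have hfix : ∀ t ∈ T, s (c t) = t := by
        intro t ht
        obtain ⟨i, rfl⟩ := h t ht
        rw [hcs]
      calc T = (T.image c).image s := by
            rw [Finset.image_image]
            ext t
            simp only [Finset.mem_image, Function.comp]
            exact ⟨fun ht => ⟨t, ht, hfix t ht⟩, fun ⟨z, hz, hzt⟩ => by
              rw [← hzt, hfix z hz]; exact hz⟩
        _ = T₀ := by rw [hTim]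
    choose m hmT hm using fun i => Finset.exists_min_image T (u i) ⟨y, hyT⟩
    obtain ⟨p, q, hpq, h⟩ := card_dominant_insert_eq_two u hu T hTdom hTc m hmT hm fun j =>
      ⟨s j, fun i hij => by
        by_cases hmi : m i ∈ range s
        · obtain ⟨l, hl⟩ := hmi
          have hli : l = i := by
            by_contra hli
            exact absurd (hm i y hyT) (not_le.2 (hl ▸ hmax i l y hli hy))
          rw [← hl, hli]
          exact lt_of_le_of_ne (hmin i _) fun h => hij (hs (hu i h))
        · exact hmax i j _ hij.symm hmi⟩
    rw [← Finset.card_pair hpq]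
    congr 1
    ext x
    simpa using h x
  rw [← Finset.add_sum_erase _ _ hT₀, hodd, Finset.sum_congr rfl htwo, Finset.sum_const] at hcount
  rw [← hcount] at heven
  simp [Nat.even_add, parity_simps] at heven

end Scarf

/-! ### Maps of the simplex that preserve faces -/

/-- In every colouring of the points of the integral simplex `{x ∈ ℕⁿ | ∑ x_i = k}` there is a point
`x` such that for every `i` either `x i` is small or there is a point of colour `i` near `x`. -/
lemma exists_grid_point {n : ℕ} (hn : 0 < n) (k : ℕ)
    (c : {x : Fin n → ℕ // ∑ i, x i = k} → Fin n) :
    ∃ x : {x : Fin n → ℕ // ∑ i, x i = k}, ∀ i, x.1 i ≤ n ∨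
      ∃ y, c y = i ∧ ∀ j, x.1 j ≤ y.1 j + n ∧ y.1 j ≤ x.1 j + n := by
  classical
  let X := {x : Fin n → ℕ // ∑ i, x i = k}
  have : Fintype X := by
    have : Finite X := Finite.of_injective
      (fun (x : X) (i : Fin n) => (⟨x.1 i, Nat.lt_succ_of_le
        ((Finset.single_le_sum (fun _ _ => Nat.zero_le _) (Finset.mem_univ i)).trans x.2.le)⟩ :
          Fin (k + 1)))
      fun x y h => Subtype.ext (funext fun i => by simpa using congrFun h i)
    exact Fintype.ofFinite X
  let Y := X ⊕ Fin n
  let w : Fin n → Y → ℕ := fun i => Sum.elim (fun x => x.1 i + 1) fun j => if j = i then 0 else k + 2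
  let u : Fin n → Y → ℕ ×ₗ ℕ := fun i y => toLex (w i y, (Fintype.equivFin Y y).1)
  have hle : ∀ i y z, u i y ≤ u i z → w i y ≤ w i z := fun i y z h => by
    rcases Prod.Lex.toLex_le_toLex.1 h with h | h
    exacts [h.le, h.1.le]
  have hlt : ∀ i y z, w i y < w i z → u i y < u i z := fun i y z h =>
    Prod.Lex.toLex_lt_toLex.2 (Or.inl h)
  have hu : ∀ i, Function.Injective (u i) := fun i y z h => by
    have := congrArg (fun p => (ofLex p).2) h
    exact (Fintype.equivFin Y).injective (Fin.ext this)
  have hk : ∀ (x : X) i, x.1 i ≤ k := fun x i =>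
    (Finset.single_le_sum (fun _ _ => Nat.zero_le _) (Finset.mem_univ i)).trans x.2.le
  let x₀ : X := ⟨Pi.single ⟨0, hn⟩ k, by simp⟩
  have : Nonempty (Fin n) := ⟨⟨0, hn⟩⟩
  obtain ⟨R, hR, hRc⟩ := exists_dominant_image_eq_univ u hu (fun i => (Sum.inr i : Y))
    (Sum.elim c id) (fun i => rfl)
    (fun i y => by
      by_cases hy : y = Sum.inr i
      · rw [hy]
      · refine (hlt i _ _ ?_).le
        rcases y with x | j
        · simp [w]
        · have : j ≠ i := fun h => hy (by rw [h])
          simp [w, this])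
    (fun i j y hij hy => by
      refine hlt i _ _ ?_
      rcases y with x | l
      · have := hk x i
        simp [w, hij]; omega
      · exact absurd ⟨l, rfl⟩ hy)
    ⟨Sum.inl x₀, by simp⟩
  let C : Finset (Fin n) := Finset.univ.filter fun i => (Sum.inr i : Y) ∉ R
  have hdom : ∀ x : X, ∃ i ∈ C, ∀ y : X, Sum.inl y ∈ R → x.1 i ≤ y.1 i := by
    intro x
    obtain ⟨i, hi⟩ := hR (Sum.inl x)
    refine ⟨i, Finset.mem_filter.2 ⟨Finset.mem_univ _, fun h => ?_⟩, fun y hy => ?_⟩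
    · have := hle i _ _ (hi _ h)
      simp [w] at this
    · have := hle i _ _ (hi _ hy)
      simpa [w] using this
  have hcol : ∀ i ∈ C, ∃ y : X, Sum.inl y ∈ R ∧ c y = i := by
    intro i hi
    have : i ∈ R.image (Sum.elim c id) := by rw [hRc]; exact Finset.mem_univ _
    obtain ⟨y, hy, hyi⟩ := Finset.mem_image.1 this
    rcases y with y | j
    · exact ⟨y, hy, hyi⟩
    · simp only [Sum.elim_inr, id] at hyi
      subst hyi
      exact absurd hy (Finset.mem_filter.1 hi).2
  obtain ⟨i₁, hi₁, -⟩ := hdom x₀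
  obtain ⟨x, hxR, -⟩ := hcol i₁ hi₁
  choose m hmR hm using fun i => Finset.exists_min_image
    (Finset.univ.filter fun y : X => Sum.inl y ∈ R) (fun y : X => y.1 i) ⟨x, by simpa using hxR⟩
  simp only [Finset.mem_filter, Finset.mem_univ, true_and] at hmR hm
  have hsum : k < ∑ i ∈ C, ((m i).1 i + 1) := by
    by_contra! h
    let z : Fin n → ℕ := fun i => (if i ∈ C then (m i).1 i + 1 else 0) +
      if i = i₁ then k - ∑ i ∈ C, ((m i).1 i + 1) else 0
    have hz : ∑ i, z i = k := by
      simp only [z, Finset.sum_add_distrib, Finset.sum_ite_mem, Finset.univ_inter,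
        Finset.sum_ite_eq', Finset.mem_univ, if_true] at h ⊢
      omega
    obtain ⟨i, hi, hi'⟩ := hdom ⟨z, hz⟩
    have := hi' (m i) (hmR i)
    simp only [z, hi, if_true] at this
    omega
  have hCn : C.card ≤ n := by simpa using Finset.card_le_univ C
  have hclose : ∀ y : X, Sum.inl y ∈ R →
      (∀ i ∈ C, (m i).1 i ≤ y.1 i ∧ y.1 i ≤ (m i).1 i + n) ∧ ∀ i ∉ C, y.1 i ≤ n := by
    intro y hy
    have h1 : ∑ i ∈ C, y.1 i + ∑ i ∈ Cᶜ, y.1 i = k := by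
      rw [Finset.sum_add_sum_compl, y.2]
    have h2 : ∑ i ∈ C, y.1 i = ∑ i ∈ C, (m i).1 i + ∑ i ∈ C, (y.1 i - (m i).1 i) := by
      rw [← Finset.sum_add_distrib]
      exact Finset.sum_congr rfl fun i _ => by have := hm i y hy; omega
    rw [Finset.sum_add_distrib, Finset.sum_const, smul_eq_mul, mul_one] at hsum
    refine ⟨fun i hi => ⟨hm i y hy, ?_⟩, fun i hi => ?_⟩
    · have : y.1 i - (m i).1 i ≤ ∑ i ∈ C, (y.1 i - (m i).1 i) :=
        Finset.single_le_sum (f := fun i => y.1 i - (m i).1 i) (fun _ _ => Nat.zero_le _) hi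
      omega
    · have : y.1 i ≤ ∑ i ∈ Cᶜ, y.1 i :=
        Finset.single_le_sum (f := fun i => y.1 i) (fun _ _ => Nat.zero_le _)
          (Finset.mem_compl.2 hi)
      omega
  refine ⟨x, fun i => ?_⟩
  by_cases hi : i ∈ C
  · right
    obtain ⟨y, hyR, hyi⟩ := hcol i hi
    refine ⟨y, hyi, fun j => ?_⟩
    by_cases hj : j ∈ C
    · have h1 := (hclose x hxR).1 j hj
      have h2 := (hclose y hyR).1 j hj
      omega
    · have h1 := (hclose x hxR).2 j hj
      have h2 := (hclose y hyR).2 j hj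
      omega
  · exact Or.inl ((hclose x hxR).2 i hi)

/-- A continuous self-map of the standard simplex that preserves all faces attains the
barycenter. -/
theorem exists_eq_barycenter {n : ℕ} (hn : 0 < n) (h : (Fin n → ℝ) → Fin n → ℝ)
    (hc : ContinuousOn h (stdSimplex ℝ (Fin n)))
    (hmaps : MapsTo h (stdSimplex ℝ (Fin n)) (stdSimplex ℝ (Fin n)))
    (hface : ∀ b ∈ stdSimplex ℝ (Fin n), ∀ i, b i = 0 → h b i = 0) :
    ∃ b ∈ stdSimplex ℝ (Fin n), h b = fun _ => (n : ℝ)⁻¹ := by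
  have hn' : (0 : ℝ) < n := by exact_mod_cast hn
  let pt : (k : ℕ) → {x : Fin n → ℕ // ∑ i, x i = k + 1} → Fin n → ℝ :=
    fun k x i => (x.1 i : ℝ) / (k + 1)
  have hpt : ∀ k x, pt k x ∈ stdSimplex ℝ (Fin n) := by
    intro k x
    refine ⟨fun i => by positivity, ?_⟩
    simp only [pt]
    rw [← Finset.sum_div, ← Nat.cast_sum, x.2]
    push_cast
    exact div_self (by positivity)
  have hsmall : ∀ b ∈ stdSimplex ℝ (Fin n), ∃ i, h b i ≤ (n : ℝ)⁻¹ := by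
    intro b hb
    by_contra! hlt
    have hsum : ∑ _i : Fin n, (n : ℝ)⁻¹ < ∑ i, h b i :=
      Finset.sum_lt_sum_of_nonempty ⟨⟨0, hn⟩, Finset.mem_univ _⟩ fun i _ => hlt i
    rw [(hmaps hb).2] at hsum
    simp [hn'.ne'] at hsum
  choose c hcol using fun k x => hsmall (pt k x) (hpt k x)
  choose x hx using fun k => exists_grid_point hn (k + 1) (c k)
  let 𝒰 : Ultrafilter ℕ := Filter.hyperfilter ℕ
  have h𝒰 : (𝒰 : Filter ℕ) ≤ Filter.atTop := by
    rw [← Nat.cofinite_eq_atTop]; exact Filter.hyperfilter_le_cofinite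
  obtain ⟨b, hb, hlim⟩ := (isCompact_stdSimplex ℝ (Fin n)).ultrafilter_le_nhds
    (𝒰.map fun k => pt k (x k))
    (Filter.le_principal_iff.2 (show ∀ᶠ k in (𝒰 : Filter ℕ), pt k (x k) ∈ stdSimplex ℝ (Fin n) from
      Filter.Eventually.of_forall fun k => hpt k (x k)))
  have hlim : Filter.Tendsto (fun k => pt k (x k)) 𝒰 (nhds b) := hlim
  have hsm : Filter.Tendsto (fun k : ℕ => (n : ℝ) / (k + 1)) 𝒰 (nhds 0) :=
    ((tendsto_const_div_atTop_nhds_zero_nat (n : ℝ)).comp (Filter.tendsto_add_atTop_nat 1)).congr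
      (fun k => by simp) |>.mono_left h𝒰
  have hall : ∀ i, h b i ≤ (n : ℝ)⁻¹ := by
    intro i
    rcases Ultrafilter.em 𝒰 fun k => (x k).1 i ≤ n with hi | hi
    · have : b i ≤ 0 := by
        refine le_of_tendsto_of_tendsto (tendsto_pi_nhds.1 hlim i) hsm ?_
        filter_upwards [hi] with k hk
        simp only [pt]
        gcongr
      rw [hface b hb i (le_antisymm this (hb.1 i))]
      positivity
    · have hy : ∀ k, ∃ y, ¬ (x k).1 i ≤ n → c k y = i ∧
          ∀ j, (x k).1 j ≤ y.1 j + n ∧ y.1 j ≤ (x k).1 j + n := by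
        intro k
        by_cases hk : (x k).1 i ≤ n
        · exact ⟨x k, fun h => absurd hk h⟩
        · obtain ⟨y, hy⟩ := (hx k i).resolve_left hk
          exact ⟨y, fun _ => hy⟩
      choose y hy using hy
      have hylim : Filter.Tendsto (fun k => pt k (y k)) 𝒰 (nhds b) := by
        refine tendsto_pi_nhds.2 fun j => ?_
        have h1 := (tendsto_pi_nhds.1 hlim j).sub hsm
        have h2 := (tendsto_pi_nhds.1 hlim j).add hsm
        rw [sub_zero] at h1
        rw [add_zero] at h2
        refine tendsto_of_tendsto_of_tendsto_of_le_of_le' h1 h2 ?_ ?_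
        · filter_upwards [hi] with k hk
          have : ((x k).1 j : ℝ) ≤ (y k).1 j + n := by exact_mod_cast ((hy k hk).2 j).1
          simp only [pt]
          rw [← sub_div]
          gcongr
          linarith
        · filter_upwards [hi] with k hk
          have : ((y k).1 j : ℝ) ≤ (x k).1 j + n := by exact_mod_cast ((hy k hk).2 j).2
          simp only [pt]
          rw [← add_div]
          gcongr
      have hyw : Filter.Tendsto (fun k => pt k (y k)) 𝒰 (nhdsWithin b (stdSimplex ℝ (Fin n))) :=
        tendsto_nhdsWithin_iff.2 ⟨hylim, Filter.Eventually.of_forall fun k => hpt k (y k)⟩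
      have := tendsto_pi_nhds.1 ((hc b hb).tendsto.comp hyw) i
      refine le_of_tendsto this ?_
      filter_upwards [hi] with k hk
      have := hcol k (y k)
      rwa [(hy k hk).1] at this
  refine ⟨b, hb, ?_⟩
  have hsum : ∑ i, h b i = ∑ _i : Fin n, (n : ℝ)⁻¹ := by
    rw [(hmaps hb).2]; simp [hn'.ne']
  funext i
  exact (Finset.sum_eq_sum_iff_of_le fun i _ => hall i).1 hsum i (Finset.mem_univ i)

namespace ScarfGame

/-! ### The function `τ` and the induced cover -/

namespace GenGame

variable {ι : Type} [Fintype ι] {n d : ℕ} (G : GenGame ι n d)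

lemma le_add_norm_sub (x y : Fin n → ℝ) : x ≤ y + ‖x - y‖ • (1 : Fin n → ℝ) := fun j => by
  have := (le_abs_self _).trans (norm_le_pi_norm (x - y) j)
  simp at this ⊢
  linarith

lemma bddAbove_tau (x : Fin n → ℝ) : BddAbove {t : ℝ | x + t • 1 ∈ ⋃ i, G.U i} := by
  choose z hz using fun i => (ne_univ_iff_exists_notMem (G.U i)).1 (G.proper i)
  refine ⟨∑ i, ‖z i - x‖, ?_⟩
  rintro t ht
  obtain ⟨i, hi⟩ := mem_iUnion.1 ht
  refine le_trans ?_ (Finset.single_le_sum (f := fun i => ‖z i - x‖)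
    (fun _ _ => norm_nonneg _) (Finset.mem_univ i))
  by_contra! hlt
  refine hz i (G.comprehensive i _ hi _ ((le_add_norm_sub _ x).trans fun j => ?_))
  simpa using hlt.le

lemma nonempty_tau [Nonempty ι] (x : Fin n → ℝ) : {t : ℝ | x + t • 1 ∈ ⋃ i, G.U i}.Nonempty := by
  obtain ⟨w, hw⟩ := G.nonempty (Classical.arbitrary ι)
  refine ⟨-‖x - w‖, mem_iUnion.2 ⟨_, G.comprehensive _ _ hw _ fun j => ?_⟩⟩
  have := le_add_norm_sub x w j
  simp at this ⊢
  linarith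

lemma le_tau {x : Fin n → ℝ} {t : ℝ} {i : ι} (h : x + t • 1 ∈ G.U i) : t ≤ G.tau x :=
  le_csSup (G.bddAbove_tau x) (mem_iUnion.2 ⟨i, h⟩)

lemma exists_mem_cover [Nonempty ι] (x : Fin n → ℝ) : ∃ i, x ∈ G.cover i := by
  have hcl : IsClosed {t : ℝ | x + t • 1 ∈ ⋃ i, G.U i} :=
    (isClosed_iUnion_of_finite G.closed).preimage
      (f := fun t : ℝ => x + t • (1 : Fin n → ℝ)) (by fun_prop)
  have : x + G.tau x • 1 ∈ ⋃ i, G.U i := hcl.csSup_mem (G.nonempty_tau x) (G.bddAbove_tau x)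
  obtain ⟨i, hi⟩ := mem_iUnion.1 this
  exact ⟨i, hi⟩

lemma continuous_tau [Nonempty ι] : Continuous G.tau := by
  refine (LipschitzWith.of_le_add fun x y => ?_).continuous
  obtain ⟨i, hi⟩ := G.exists_mem_cover x
  have : G.tau x - dist x y ≤ G.tau y := by
    refine G.le_tau (i := i) (G.comprehensive i _ hi _ fun j => ?_)
    have := le_add_norm_sub y x j
    rw [dist_comm, dist_eq_norm]
    simp at this ⊢
    linarith
  linarith

lemma isClosed_cover [Nonempty ι] (i : ι) : IsClosed (G.cover i) :=
  (G.closed i).preimage (by have := G.continuous_tau; fun_prop)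

lemma tau_add [Nonempty ι] (x : Fin n → ℝ) (t : ℝ) : G.tau (x + t • 1) = G.tau x - t := by
  obtain ⟨i, hi⟩ := G.exists_mem_cover x
  obtain ⟨j, hj⟩ := G.exists_mem_cover (x + t • 1)
  apply le_antisymm
  · have : t + G.tau (x + t • 1) ≤ G.tau x := G.le_tau (i := j) (by
      rw [add_smul, ← add_assoc]; exact hj)
    linarith
  · refine G.le_tau (i := i) ?_
    rw [add_assoc, ← add_smul, add_sub_cancel]
    exact hi

lemma add_smul_mem_cover [Nonempty ι] {x : Fin n → ℝ} (t : ℝ) {i : ι} :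
    x + t • 1 ∈ G.cover i ↔ x ∈ G.cover i := by
  simp only [cover, Set.mem_ofPred_eq, tau_add]
  rw [add_assoc, ← add_smul, add_sub_cancel]

lemma add_tau_notMem_interior (x : Fin n → ℝ) (i : ι) :
    x + G.tau x • 1 ∉ interior (G.U i) := by
  intro h
  have hc : ContinuousAt (fun t : ℝ => x + t • (1 : Fin n → ℝ)) (G.tau x) := by fun_prop
  have hev := hc.eventually (mem_interior_iff_mem_nhds.1 h)
  obtain ⟨ε, hε, hb⟩ := Metric.eventually_nhds_iff.1 hev
  have := G.le_tau (hb (y := G.tau x + ε / 2) (by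
    rw [Real.dist_eq, add_sub_cancel_left, abs_of_pos (by positivity)]; linarith))
  linarith

end GenGame

instance {n : ℕ} [NeZero n] : Nonempty (Coalition n) := ⟨single 0⟩

/-- On the member `F_S` of the cover induced by an NTU game, the coordinates in `S` exceed the
others at most by a constant. -/
lemma NTUGame.exists_sub_lt {n : ℕ} (hn : 0 < n) (N : NTUGame n) :
    ∃ L : ℝ, 0 < L ∧ ∀ S p, p ∈ (N.toGen hn).cover S → ∀ i ∈ S.1, ∀ j, p i - p j < L := by
  choose B hB using N.bounded
  choose a ha using fun i => N.nonempty (single i)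
  have hself : ∀ i : Fin n, i ∈ (single i).1 := fun i => Finset.mem_singleton_self i
  refine ⟨∑ S, |B S| + ∑ j, |a j ⟨j, hself j⟩| + 1, by positivity, fun S p hp i hi j => ?_⟩
  have hrat : ∀ i, ∀ y ∈ N.V (single i), ∀ k, y k ≤ p i + (N.toGen hn).tau p := by
    intro i y hy k
    have : y k - p i ≤ (N.toGen hn).tau p := by
      refine (N.toGen hn).le_tau (i := single i) (N.comprehensive _ y hy _ fun l => ?_)
      have hl : l.1 = i := Finset.mem_singleton.1 l.2
      have hk : k.1 = i := Finset.mem_singleton.1 k.2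
      have hkl : k = l := Subtype.ext (hk.trans hl.symm)
      simp [hl, hkl]
    linarith
  have h1 := hB S _ hp (fun i y hy k => by simpa using hrat i y hy k) ⟨i, hi⟩
  have h2 := hrat j _ (ha j) ⟨j, hself j⟩
  have h3 : |B S| ≤ ∑ S, |B S| :=
    Finset.single_le_sum (f := fun S => |B S|) (fun _ _ => abs_nonneg _) (Finset.mem_univ S)
  have h4 : |a j ⟨j, hself j⟩| ≤ ∑ j, |a j ⟨j, hself j⟩| :=
    Finset.single_le_sum (f := fun j => |a j ⟨j, hself j⟩|) (fun _ _ => abs_nonneg _)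
      (Finset.mem_univ j)
  have h5 := le_abs_self (B S)
  have h6 := neg_abs_le (a j ⟨j, hself j⟩)
  simp at h1
  linarith

/-! ### Faces of the simplex -/

lemma mem_face_iff {n : ℕ} {M : ℝ} (hM : 0 < M) {T : Finset (Fin n)} {p : Fin n → ℝ} :
    p ∈ face M T ↔ (∀ i, p i ≤ 0) ∧ ∑ i, p i = -M ∧ ∀ j ∉ T, p j = 0 := by
  constructor
  · have hconv : Convex ℝ {p : Fin n → ℝ | (∀ i, p i ≤ 0) ∧ ∑ i, p i = -M ∧ ∀ j ∉ T, p j = 0} := by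
      rintro x ⟨hx1, hx2, hx3⟩ y ⟨hy1, hy2, hy3⟩ a b ha hb hab
      refine ⟨fun i => ?_, ?_, fun j hj => ?_⟩
      · have := mul_nonneg ha (neg_nonneg.2 (hx1 i))
        have := mul_nonneg hb (neg_nonneg.2 (hy1 i))
        simp only [Pi.add_apply, Pi.smul_apply, smul_eq_mul]
        linarith
      · simp only [Pi.add_apply, Pi.smul_apply, smul_eq_mul, Finset.sum_add_distrib,
          ← Finset.mul_sum, hx2, hy2]
        rw [← add_mul, hab, one_mul]
      · simp [hx3 j hj, hy3 j hj]
    refine fun hp => convexHull_min ?_ hconv hp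
    rintro _ ⟨i, hi, rfl⟩
    refine ⟨fun j => ?_, by simp, fun j hj => ?_⟩
    · by_cases h : j = i
      · subst h; simpa using hM.le
      · simp [h]
    · have : j ≠ i := fun h => hj (h ▸ hi)
      simp [this]
  · rintro ⟨h1, h2, h3⟩
    have hsum : ∑ i ∈ T, p i = -M := by
      rw [← h2]
      exact Finset.sum_subset (Finset.subset_univ T) fun j _ hj => h3 j hj
    have hp : p = ∑ i ∈ T, (-M⁻¹ * p i) • (Pi.single i (-M) : Fin n → ℝ) := by
      ext j
      rw [Finset.sum_apply]
      by_cases hj : j ∈ T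
      · rw [Finset.sum_eq_single_of_mem j hj]
        · simp; field_simp
        · intro i _ hij
          simp [hij.symm]
      · rw [h3 j hj, Finset.sum_eq_zero]
        intro i hi
        have : j ≠ i := fun h => hj (h ▸ hi)
        simp [this]
    rw [hp]
    refine (convex_convexHull ℝ _).sum_mem (fun i _ => ?_) ?_ fun i hi =>
      subset_convexHull _ _ ⟨i, hi, rfl⟩
    · have := mul_nonneg (inv_nonneg.2 hM.le) (neg_nonneg.2 (h1 i))
      linarith
    · rw [← Finset.mul_sum, hsum]
      field_simp

lemma mem_boundary_iff {n : ℕ} {M : ℝ} (hM : 0 < M) {p : Fin n → ℝ} :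
    p ∈ boundary n M ↔ (∀ i, p i ≤ 0) ∧ ∑ i, p i = -M ∧ ∃ j, p j = 0 := by
  simp only [boundary, mem_iUnion, mem_face_iff hM]
  constructor
  · rintro ⟨⟨T, hT⟩, h1, h2, h3⟩
    obtain ⟨j, hj⟩ : ∃ j, j ∉ T := by
      by_contra! h
      exact hT (Finset.eq_univ_of_forall h)
    exact ⟨h1, h2, j, h3 j hj⟩
  · rintro ⟨h1, h2, j, hj⟩
    refine ⟨⟨Finset.univ.erase j, fun h => ?_⟩, h1, h2, fun i hi => ?_⟩
    · exact Finset.notMem_erase j Finset.univ (h.symm ▸ Finset.mem_univ j)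
    · have : i = j := by simpa using hi
      rw [this, hj]

lemma mem_simplex_iff {n : ℕ} {M : ℝ} (hM : 0 < M) {p : Fin n → ℝ} :
    p ∈ simplex n M ↔ (∀ i, p i ≤ 0) ∧ ∑ i, p i = -M := by
  simp [simplex, mem_face_iff hM]

lemma mem_simplex_iff_smul_mem_stdSimplex {n : ℕ} {M : ℝ} (hM : 0 < M) {p : Fin n → ℝ} :
    p ∈ simplex n M ↔ -M⁻¹ • p ∈ stdSimplex ℝ (Fin n) := by
  rw [mem_simplex_iff hM]
  simp only [stdSimplex, Set.mem_ofPred_eq, Pi.smul_apply, smul_eq_mul, ← Finset.mul_sum]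
  refine and_congr (forall_congr' fun i => ?_) ?_
  · rw [neg_mul, neg_nonneg]
    exact ⟨fun h => mul_nonpos_of_nonneg_of_nonpos (inv_nonneg.2 hM.le) h, fun h => by
      by_contra! hp
      exact absurd (mul_pos (inv_pos.2 hM) hp) (not_lt.2 h)⟩
  · constructor
    · intro h
      rw [h]; field_simp
    · intro h
      field_simp at h
      linarith

/-- In a large simplex, the coordinates in `S` of the points of `F_S` are nonzero. -/
lemma NTUGame.exists_forall_lt_zero {n : ℕ} (hn : 0 < n) (N : NTUGame n) :
    ∃ M₀ : ℝ, ∀ M : ℝ, 0 < M → M₀ ≤ M → ∀ p ∈ simplex n M, ∀ S, p ∈ (N.toGen hn).cover S →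
      ∀ i ∈ S.1, p i < 0 := by
  obtain ⟨L, hL, h⟩ := N.exists_sub_lt hn
  refine ⟨n * L, fun M hM hLM p hp S hpS i hi => ?_⟩
  obtain ⟨-, hsum⟩ := (mem_simplex_iff hM).1 hp
  by_contra! hpi
  have hlt : ∑ _j : Fin n, (-L) < ∑ j, p j :=
    Finset.sum_lt_sum_of_nonempty ⟨⟨0, hn⟩, Finset.mem_univ _⟩ fun j _ => by
      have := h S p hpS i hi j
      linarith
  rw [hsum] at hlt
  simp at hlt
  linarith

end ScarfGame

/-! ### Swelling closed families -/

/-- A finite family of closed subsets of a compact metric space is contained in a family of open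
sets with the same pattern of nonempty intersections. -/
lemma exists_isOpen_superset_iInter_nonempty_iff {ι X : Type*} [Finite ι] [MetricSpace X]
    [CompactSpace X] (F : ι → Set X) (hF : ∀ i, IsClosed (F i)) :
    ∃ W : ι → Set X, (∀ i, IsOpen (W i)) ∧ (∀ i, F i ⊆ W i) ∧
      ∀ S : Finset ι, (⋂ i ∈ S, F i).Nonempty ↔ (⋂ i ∈ S, W i).Nonempty := by
  classical
  have := Fintype.ofFinite ι
  have key : ∀ S : Finset ι, ∃ ε > 0, (⋂ i ∈ S, thickening ε (F i)).Nonempty →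
      (⋂ i ∈ S, F i).Nonempty := by
    intro S
    by_cases hne : (⋂ i ∈ S, F i).Nonempty
    · exact ⟨1, one_pos, fun _ => hne⟩
    by_cases hemp : ∃ i ∈ S, F i = ∅
    · obtain ⟨i, hi, hFi⟩ := hemp
      refine ⟨1, one_pos, fun ⟨x, hx⟩ => ?_⟩
      have := mem_iInter₂.1 hx i hi
      simp [hFi] at this
    push Not at hemp
    rcases isEmpty_or_nonempty X with hX | hX
    · exact ⟨1, one_pos, fun ⟨x, _⟩ => (hX.false x).elim⟩
    have hcont : Continuous fun x => ∑ i ∈ S, infDist x (F i) :=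
      continuous_finsetSum _ fun i _ => continuous_infDist_pt _
    obtain ⟨x₀, -, hx₀⟩ := isCompact_univ.exists_isMinOn univ_nonempty hcont.continuousOn
    have hpos : 0 < ∑ i ∈ S, infDist x₀ (F i) := by
      by_contra! hle
      have h0 := (Finset.sum_eq_zero_iff_of_nonneg fun i _ => infDist_nonneg).1
        (le_antisymm hle (Finset.sum_nonneg fun i _ => infDist_nonneg))
      exact hne ⟨x₀, mem_iInter₂.2 fun i hi =>
        ((hF i).mem_iff_infDist_zero (hemp i hi)).2 (h0 i hi)⟩
    refine ⟨(∑ i ∈ S, infDist x₀ (F i)) / (S.card + 1), by positivity, fun ⟨x, hx⟩ => ?_⟩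
    exfalso
    have h1 : ∑ i ∈ S, infDist x₀ (F i) ≤ ∑ i ∈ S, infDist x (F i) := hx₀ (mem_univ x)
    have h2 : ∑ i ∈ S, infDist x (F i) ≤
        ∑ _i ∈ S, (∑ i ∈ S, infDist x₀ (F i)) / (S.card + 1) :=
      Finset.sum_le_sum fun i hi =>
        ((mem_thickening_iff_infDist_lt (hemp i hi)).1 (mem_iInter₂.1 hx i hi)).le
    rw [Finset.sum_const, nsmul_eq_mul] at h2
    have h3 := h1.trans h2
    rw [mul_div_assoc', le_div_iff₀ (by positivity)] at h3
    linarith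
  choose ε hε h using key
  let δ := Finset.univ.inf' Finset.univ_nonempty ε
  have hδ : 0 < δ := (Finset.lt_inf'_iff _).2 fun S _ => hε S
  refine ⟨fun i => thickening δ (F i), fun i => isOpen_thickening,
    fun i => self_subset_thickening hδ _, fun S => ⟨fun hne => hne.mono ?_, fun hne => h S ?_⟩⟩
  · exact iInter₂_mono fun i _ => self_subset_thickening hδ _
  · exact hne.mono (iInter₂_mono fun i _ =>
      thickening_mono (Finset.inf'_le _ (Finset.mem_univ S)) _)

namespace ScarfGame

/-! ### The firms `1_S / |S|` -/

section Firms

variable {n : ℕ}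

lemma firm_apply_of_notMem {S : Coalition n} {i : Fin n} (h : i ∉ S.1) : firm S i = 0 := by
  simp [firm, h]

lemma firm_nonneg (S : Coalition n) (i : Fin n) : 0 ≤ firm S i := by
  simp only [firm]
  split_ifs <;> positivity

lemma sum_firm (S : Coalition n) : ∑ i, firm S i = 1 := by
  have : 0 < S.1.card := Finset.card_pos.2 S.2
  simp [firm, Finset.sum_ite_mem]
  field_simp

lemma sum_eq_zero_of_mem_vectorSpan {u : EuclideanSpace ℝ (Fin n)}
    (hu : u ∈ vectorSpan ℝ (range (firm (n := n)))) : ∑ i, u i = 0 := by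
  let l : EuclideanSpace ℝ (Fin n) →ₗ[ℝ] ℝ :=
    { toFun := fun u => ∑ i, u i
      map_add' := fun u w => by simp [Finset.sum_add_distrib]
      map_smul' := fun a u => by simp [Finset.mul_sum] }
  have : vectorSpan ℝ (range (firm (n := n))) ≤ LinearMap.ker l := by
    refine Submodule.span_le.2 ?_
    rintro _ ⟨_, ⟨S, rfl⟩, _, ⟨T, rfl⟩, rfl⟩
    simp [l, sum_firm]
  exact this hu

lemma sum_smul_firm_sub_bary_mem (hn : 0 < n) {w : Coalition n → ℝ} (h0 : ∀ S, 0 ≤ w S)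
    (h1 : ∑ S, w S = 1) :
    ∑ S, w S • firm S - bary n ∈ vectorSpan ℝ (range (firm (n := n))) := by
  rw [← vsub_eq_sub]
  refine vsub_mem_vectorSpan_of_mem_affineSpan_of_mem_affineSpan ?_
    (subset_affineSpan _ _ ⟨grand hn, firm_grand hn⟩)
  exact convexHull_subset_affineSpan _ ((convex_convexHull ℝ _).sum_mem (fun S _ => h0 S) h1
    fun S _ => subset_convexHull _ _ ⟨S, rfl⟩)

lemma sum_smul_firm_apply_eq_zero {w : Coalition n → ℝ} {j : Fin n}
    (h : ∀ S, w S ≠ 0 → j ∉ S.1) : (∑ S, w S • firm S) j = 0 := by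
  rw [WithLp.ofLp_sum, Finset.sum_apply]
  refine Finset.sum_eq_zero fun S _ => ?_
  by_cases hS : w S = 0
  · simp [hS]
  · simp [firm_apply_of_notMem (h S hS)]

lemma not_isConvRBalanced {Φ : Finset (Coalition n)} {j : Fin n} (h : ∀ S ∈ Φ, j ∉ S.1) :
    ¬ IsConvRBalanced firm (bary n) Φ := by
  intro hb
  have : convexHull ℝ (firm '' (Φ : Set (Coalition n))) ⊆
      {x : EuclideanSpace ℝ (Fin n) | x j = 0} := by
    refine convexHull_min ?_ ?_
    · rintro _ ⟨S, hS, rfl⟩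
      exact firm_apply_of_notMem (h S hS)
    · intro x hx y hy a b _ _ _
      have hx : x j = 0 := hx
      have hy : y j = 0 := hy
      simp [hx, hy]
  have h0 : bary n j = 0 := this hb
  have hn := j.pos
  simp [bary] at h0
  omega

end Firms

/-! ### Maps associated with covers -/

section CoverMaps

variable {ι : Type} {d : ℕ} {X : Type} [TopologicalSpace X]

/-- Maps to the sphere of directions whose values always lie in a common coordinate half-space are
homotopic. -/
lemma homotopic_of_forall_exists_neg {v : ι → EuclideanSpace ℝ (Fin d)}
    (f g : C(X, dirSphere v)) (h : ∀ x, ∃ j, (f x).1 j < 0 ∧ (g x).1 j < 0) :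
    f.Homotopic g := by
  let a : unitInterval × X → EuclideanSpace ℝ (Fin d) := fun p =>
    (1 - (p.1 : ℝ)) • (f p.2).1 + (p.1 : ℝ) • (g p.2).1
  have ha : Continuous a := by fun_prop
  have ha0 : ∀ p, ‖a p‖ ≠ 0 := by
    intro p hp
    obtain ⟨j, hf, hg⟩ := h p.2
    have h0 : a p j = 0 := by rw [norm_eq_zero.1 hp]; rfl
    simp only [a, PiLp.add_apply, PiLp.smul_apply, smul_eq_mul] at h0
    have ht0 := p.1.2.1
    have ht1 := p.1.2.2
    rcases eq_or_lt_of_le ht0 with ht | ht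
    · rw [← ht] at h0; simp at h0; linarith
    · nlinarith [mul_neg_of_pos_of_neg ht hg,
        mul_nonpos_of_nonneg_of_nonpos (sub_nonneg.2 ht1) hf.le]
  refine ⟨⟨⟨fun p => ⟨‖a p‖⁻¹ • a p, Submodule.smul_mem _ _ (Submodule.add_mem _
    (Submodule.smul_mem _ _ (f p.2).2.1) (Submodule.smul_mem _ _ (g p.2).2.1)), ?_⟩, ?_⟩, ?_, ?_⟩⟩
  · rw [norm_smul, norm_inv, norm_norm, inv_mul_cancel₀ (ha0 p)]
  · exact ((ha.norm.inv₀ ha0).smul ha).subtype_mk _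
  · intro x
    have : a (0, x) = (f x).1 := by simp [a]
    simp [this, (f x).2.2]
  · intro x
    have : a (1, x) = (g x).1 := by simp [a]
    simp [this, (g x).2.2]

variable {n : ℕ}

lemma _root_.PartitionOfUnity.sum_eq_one_of_fintype {ι : Type*} [Fintype ι]
    (φ : PartitionOfUnity ι X) (x : X) : ∑ i, φ i x = 1 := by
  rw [← finsum_eq_sum_of_fintype]
  exact φ.sum_eq_one (mem_univ x)

lemma _root_.PartitionOfUnity.IsSubordinate.mem_of_ne_zero {ι : Type*}
    {φ : PartitionOfUnity ι X} {W : ι → Set X} (h : φ.IsSubordinate W) {i : ι} {x : X}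
    (hx : φ i x ≠ 0) : x ∈ W i :=
  h i (subset_tsupport _ hx)

lemma continuous_sum_smul_firm (φ : PartitionOfUnity (Coalition n) X) :
    Continuous fun x => ∑ S, φ S x • firm S :=
  continuous_finsetSum _ fun S _ => (φ S).continuous.smul continuous_const

/-- The map to the sphere of directions given by a partition of unity for which at every point some
player belongs to none of the coalitions of positive weight. -/
lemma exists_dirSphere_map (hn : 0 < n) (φ : PartitionOfUnity (Coalition n) X)
    (h : ∀ x, ∃ j, ∀ S, φ S x ≠ 0 → j ∉ S.1) :
    ∃ g : C(X, dirSphere (firm (n := n))), ∀ x, (g x : EuclideanSpace ℝ (Fin n)) =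
      ‖∑ S, φ S x • firm S - bary n‖⁻¹ • (∑ S, φ S x • firm S - bary n) := by
  have hne : ∀ x, ‖∑ S, φ S x • firm S - bary n‖ ≠ 0 := by
    intro x hx
    obtain ⟨j, hj⟩ := h x
    have h0 := congrArg (fun y : EuclideanSpace ℝ (Fin n) => y j) (norm_eq_zero.1 hx)
    simp only [PiLp.sub_apply, sum_smul_firm_apply_eq_zero hj] at h0
    simp [bary] at h0
    omega
  have hc : Continuous fun x => ∑ S, φ S x • firm S - bary n :=
    (continuous_sum_smul_firm φ).sub continuous_const
  refine ⟨⟨fun x => ⟨‖∑ S, φ S x • firm S - bary n‖⁻¹ • (∑ S, φ S x • firm S - bary n),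
    Submodule.smul_mem _ _ (sum_smul_firm_sub_bary_mem hn
    (fun S => φ.nonneg S x) (φ.sum_eq_one_of_fintype x)), ?_⟩,
    ((hc.norm.inv₀ hne).smul hc).subtype_mk _⟩, fun x => rfl⟩
  rw [norm_smul, norm_inv, norm_norm, inv_mul_cancel₀ (hne x)]

lemma apply_neg_of_forall_notMem {g : C(X, dirSphere (firm (n := n)))}
    {φ : PartitionOfUnity (Coalition n) X} {x : X}
    (hg : (g x : EuclideanSpace ℝ (Fin n)) =
      ‖∑ S, φ S x • firm S - bary n‖⁻¹ • (∑ S, φ S x • firm S - bary n))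
    {j : Fin n} (hj : ∀ S, φ S x ≠ 0 → j ∉ S.1) : (g x).1 j < 0 := by
  have hn : (0 : ℝ) < n := by exact_mod_cast j.pos
  have hpos : 0 < ‖∑ S, φ S x • firm S - bary n‖ := by
    rw [norm_pos_iff]
    intro h0
    have := (g x).2.2
    rw [hg, h0] at this
    simp at this
  rw [hg, PiLp.smul_apply, PiLp.sub_apply, sum_smul_firm_apply_eq_zero hj]
  have : bary n j = (n : ℝ)⁻¹ := rfl
  rw [this, zero_sub, smul_eq_mul, mul_neg, neg_lt_zero]
  positivity

end CoverMaps

section BoundaryCovers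

variable {n : ℕ} {M : ℝ} {X : Type} [MetricSpace X] (hM : 0 < M)
  (s : C(X, boundary n M)) {F : Coalition n → Set X}
  (hneg : ∀ S, ∀ x ∈ F S, ∀ i ∈ S.1, (s x).1 i < 0)

include hM hneg in
lemma exists_forall_notMem_of_nonempty {Φ : Finset (Coalition n)} (h : (⋂ S ∈ Φ, F S).Nonempty) :
    ∃ j, ∀ S ∈ Φ, j ∉ S.1 := by
  obtain ⟨x, hx⟩ := h
  obtain ⟨-, -, j, hj⟩ := (mem_boundary_iff hM).1 (s x).2
  exact ⟨j, fun S hS hjS => (hneg S x (mem_iInter₂.1 hx S hS) j hjS).ne hj⟩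

include hM hneg in
lemma not_hasBalancedIntersection : ¬ HasBalancedIntersection F firm (bary n) := by
  rintro ⟨Φ, hΦ, hne⟩
  obtain ⟨j, hj⟩ := exists_forall_notMem_of_nonempty hM s hneg hne
  exact not_isConvRBalanced hj hΦ

include hM hneg in
lemma exists_forall_ne_zero_notMem {W : Coalition n → Set X} {φ : PartitionOfUnity (Coalition n) X}
    (hnerve : ∀ Φ : Finset (Coalition n), (⋂ S ∈ Φ, F S).Nonempty ↔ (⋂ S ∈ Φ, W S).Nonempty)
    (hφ : φ.IsSubordinate W) (x : X) : ∃ j, ∀ S, φ S x ≠ 0 → j ∉ S.1 := by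
  classical
  obtain ⟨j, hj⟩ := exists_forall_notMem_of_nonempty hM s hneg
    ((hnerve (Finset.univ.filter fun S => φ S x ≠ 0)).2
      ⟨x, mem_iInter₂.2 fun S hS => hφ.mem_of_ne_zero (Finset.mem_filter.1 hS).2⟩)
  exact ⟨j, fun S hS => hj S (by simpa using hS)⟩

lemma radial_apply_neg {p : boundary n M} {j : Fin n} (hj : p.1 j = 0) :
    (radial n M hM p).1 j < 0 := by
  have hn : (0 : ℝ) < n := by exact_mod_cast j.pos
  have : 0 < ‖bar M p.1 - bary n‖ := norm_pos_iff.2 (bar_mem hM p.2).1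
  have h1 : (bar M p.1 - bary n) j = -(n : ℝ)⁻¹ := by simp [bar, bary, hj]
  have h2 : (radial n M hM p).1 j = ‖bar M p.1 - bary n‖⁻¹ * (bar M p.1 - bary n) j := rfl
  rw [h2, h1, mul_neg, neg_lt_zero]
  positivity

include hneg in
/-- All maps associated with a cover of `X` that is compatible with a map `s` from `X` to the
boundary of the simplex are homotopic to the composition of `s` and the radial projection. -/
lemma homotopic_radial_comp (hn : 0 < n) (hcov : ∀ x, ∃ S, x ∈ F S)
    {g : C(X, dirSphere (firm (n := n)))} (hg : IsCoverMap F firm (bary n) g) :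
    g.Homotopic ((radial n M hM).comp s) := by
  obtain ⟨W, φ, hWo, hFW, hnerve, hφ, hg⟩ := hg
  let W' : Coalition n → Set X := fun S => W S ∩ {x | ∀ i ∈ S.1, (s x).1 i < 0}
  have hW'o : ∀ S, IsOpen (W' S) := by
    intro S
    refine (hWo S).inter ?_
    have : {x | ∀ i ∈ S.1, (s x).1 i < 0} = ⋂ i ∈ S.1, {x | (s x).1 i < 0} := by
      ext x; simp
    rw [this]
    exact isOpen_biInter_finset fun i _ => isOpen_lt
      ((continuous_apply i).comp (continuous_subtype_val.comp s.continuous)) continuous_const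
  obtain ⟨ψ, hψ⟩ := PartitionOfUnity.exists_isSubordinate isClosed_univ W' hW'o fun x _ =>
    let ⟨S, hS⟩ := hcov x
    mem_iUnion.2 ⟨S, hFW S hS, hneg S x hS⟩
  have hψW : ψ.IsSubordinate W := fun S => (hψ S).trans inter_subset_left
  obtain ⟨g', hg'⟩ := exists_dirSphere_map hn ψ
    (exists_forall_ne_zero_notMem hM s hneg hnerve hψW)
  refine (homotopic_of_forall_exists_neg g g' fun x => ?_).trans
    (homotopic_of_forall_exists_neg _ _ fun x => ?_)
  · classical
    obtain ⟨j, hj⟩ := exists_forall_notMem_of_nonempty hM s hneg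
      ((hnerve (Finset.univ.filter fun S => x ∈ W S)).2
        ⟨x, mem_iInter₂.2 fun S hS => (Finset.mem_filter.1 hS).2⟩)
    exact ⟨j, apply_neg_of_forall_notMem (hg x) fun S hS => hj S (by
        simpa using hφ.mem_of_ne_zero hS),
      apply_neg_of_forall_notMem (hg' x) fun S hS => hj S (by
        simpa using hψW.mem_of_ne_zero hS)⟩
  · obtain ⟨-, -, j, hj⟩ := (mem_boundary_iff hM).1 (s x).2
    exact ⟨j, apply_neg_of_forall_notMem (hg' x) fun S hS hjS =>
      ((hψ.mem_of_ne_zero hS).2 j hjS).ne hj, radial_apply_neg hM hj⟩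

variable [CompactSpace X]

include hM hneg in
lemma exists_isCoverMap (hn : 0 < n) (hF : ∀ S, IsClosed (F S)) (hcov : ∀ x, ∃ S, x ∈ F S) :
    ∃ g, IsCoverMap F firm (bary n) g := by
  obtain ⟨W, hWo, hFW, hnerve⟩ := exists_isOpen_superset_iInter_nonempty_iff F hF
  obtain ⟨φ, hφ⟩ := PartitionOfUnity.exists_isSubordinate isClosed_univ W hWo fun x _ =>
    let ⟨S, hS⟩ := hcov x
    mem_iUnion.2 ⟨S, hFW S hS⟩
  obtain ⟨g, hg⟩ := exists_dirSphere_map hn φ (exists_forall_ne_zero_notMem hM s hneg hnerve hφ)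
  exact ⟨g, W, φ, hWo, hFW, hnerve, hφ, hg⟩

end BoundaryCovers

lemma homologyMap_eq_of_homotopic {X Y : Type} [TopologicalSpace X] [TopologicalSpace Y] (m : ℕ)
    {f g : C(X, Y)} (h : f.Homotopic g) : homologyMap m f = homologyMap m g := by
  obtain ⟨H⟩ := h
  have H' : TopCat.Homotopy (TopCat.ofHom f) (TopCat.ofHom g) := H
  exact congrArg ModuleCat.Hom.hom
    (H'.congr_homologyMap_singularChainComplexFunctor (ModuleCat.of ℤ ℤ) m)

/-! ### A balanced intersection in the large simplex -/

/-- A cover of the simplex such that `F_S` avoids the faces opposite to the vertices in `S` has a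
balanced intersection. -/
theorem exists_isConvRBalanced_simplex_inter_nonempty {n : ℕ} (hn : 0 < n) {M : ℝ} (hM : 0 < M)
    {F : Coalition n → Set (Fin n → ℝ)} (hF : ∀ S, IsClosed (F S)) (hcov : ∀ p, ∃ S, p ∈ F S)
    (hneg : ∀ p ∈ simplex n M, ∀ S, p ∈ F S → ∀ i ∈ S.1, p i < 0) :
    ∃ Φ : Finset (Coalition n), IsConvRBalanced firm (bary n) Φ ∧
      (simplex n M ∩ ⋂ S ∈ Φ, F S).Nonempty := by
  classical
  let X := stdSimplex ℝ (Fin n)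
  have hX : ∀ b : X, -M • b.1 ∈ simplex n M := fun b => by
    rw [mem_simplex_iff_smul_mem_stdSimplex hM, smul_smul]
    simp [hM.ne']
  let F' : Coalition n → Set X := fun S => {b | -M • b.1 ∈ F S}
  obtain ⟨W, hWo, hFW, hnerve⟩ := exists_isOpen_superset_iInter_nonempty_iff F' fun S =>
    (hF S).preimage (by fun_prop)
  let W' : Coalition n → Set X := fun S => W S ∩ ⋂ i ∈ S.1, {b | 0 < b.1 i}
  obtain ⟨φ, hφ⟩ := PartitionOfUnity.exists_isSubordinate isClosed_univ W'
    (fun S => (hWo S).inter (isOpen_biInter_finset fun i _ =>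
      isOpen_lt continuous_const ((continuous_apply i).comp continuous_subtype_val)))
    fun b _ => by
      obtain ⟨S, hS⟩ := hcov (-M • b.1)
      refine mem_iUnion.2 ⟨S, hFW S hS, mem_iInter₂.2 fun i hi => ?_⟩
      have := hneg _ (hX b) S hS i hi
      simp only [Pi.smul_apply, smul_eq_mul, neg_mul, neg_lt_zero] at this
      exact pos_of_mul_pos_right this hM.le
  let h : X → Fin n → ℝ := fun b => (∑ S, φ S b • firm S).ofLp
  have hc : Continuous h := (PiLp.continuous_ofLp 2 _).comp (continuous_sum_smul_firm φ)
  have hext : ∀ b (hb : b ∈ X), Function.extend Subtype.val h 0 b = h ⟨b, hb⟩ := fun b hb =>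
    Subtype.val_injective.extend_apply h 0 ⟨b, hb⟩
  obtain ⟨b, hb, hbar⟩ := exists_eq_barycenter hn (Function.extend Subtype.val h 0)
    (by
      rw [continuousOn_iff_continuous_domRestrict]
      exact hc.congr fun b => (hext b.1 b.2).symm)
    (fun b hb => by
      rw [hext b hb]
      refine ⟨fun i => ?_, ?_⟩
      · simp only [h, WithLp.ofLp_sum, Finset.sum_apply]
        exact Finset.sum_nonneg fun S _ => mul_nonneg (φ.nonneg S _) (firm_nonneg S i)
      · simp only [h, WithLp.ofLp_sum, Finset.sum_apply, WithLp.ofLp_smul, Pi.smul_apply]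
        rw [Finset.sum_comm]
        simp only [smul_eq_mul, ← Finset.mul_sum, sum_firm, mul_one]
        exact φ.sum_eq_one_of_fintype _)
    (fun b hb i hi => by
      rw [hext b hb]
      refine sum_smul_firm_apply_eq_zero fun S hS hiS => ?_
      have : 0 < b i := mem_iInter₂.1 (hφ.mem_of_ne_zero hS).2 i hiS
      exact this.ne' hi)
  rw [hext b hb] at hbar
  have hbar : ∑ S, φ S ⟨b, hb⟩ • firm S = bary n := WithLp.ofLp_injective 2 hbar
  let Φ : Finset (Coalition n) := Finset.univ.filter fun S => φ S ⟨b, hb⟩ ≠ 0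
  obtain ⟨x, hx⟩ := (hnerve Φ).2 ⟨⟨b, hb⟩, mem_iInter₂.2 fun S hS =>
    (hφ.mem_of_ne_zero (Finset.mem_filter.1 hS).2).1⟩
  refine ⟨Φ, ?_, -M • x.1, hX x, mem_iInter₂.2 fun S hS => mem_iInter₂.1 hx S hS⟩
  have hsum : ∑ S ∈ Φ, φ S ⟨b, hb⟩ • firm S = bary n := by
    rw [← hbar]
    exact Finset.sum_filter_of_ne fun S _ hS h0 => hS (by rw [h0, zero_smul])
  have hone : ∑ S ∈ Φ, φ S ⟨b, hb⟩ = 1 := by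
    rw [← φ.sum_eq_one_of_fintype ⟨b, hb⟩]
    exact Finset.sum_filter_of_ne fun S _ hS => hS
  rw [IsConvRBalanced, ← hsum]
  exact (convex_convexHull ℝ _).sum_mem (fun S _ => φ.nonneg S _) hone fun S hS =>
    subset_convexHull _ _ ⟨S, hS, rfl⟩

/-! ### The sphere of directions is not contractible -/

lemma dirSphere_ne_zero {ι : Type} {d : ℕ} {v : ι → EuclideanSpace ℝ (Fin d)}
    (u : dirSphere v) : u.1 ≠ 0 := fun h => by
  have := u.2.2
  rw [h, norm_zero] at this
  exact zero_ne_one this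

section Depth

variable {n : ℕ} [NeZero n]

/-- The gauge of the simplex, translated so that its barycenter is the origin, divided by `n`. -/
noncomputable def depth (u : EuclideanSpace ℝ (Fin n)) : ℝ :=
  Finset.univ.sup' Finset.univ_nonempty fun i => -u i

lemma neg_le_depth (u : EuclideanSpace ℝ (Fin n)) (i : Fin n) : -u i ≤ depth u :=
  Finset.le_sup' (fun i => -u i) (Finset.mem_univ i)

lemma exists_depth_eq (u : EuclideanSpace ℝ (Fin n)) : ∃ j, depth u = -u j :=
  let ⟨j, _, hj⟩ := Finset.exists_mem_eq_sup' Finset.univ_nonempty fun i => -u i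
  ⟨j, hj⟩

lemma continuous_depth : Continuous (depth (n := n)) :=
  Continuous.finset_sup'_apply _ fun i _ => by fun_prop

lemma depth_smul {a : ℝ} (ha : 0 ≤ a) (u : EuclideanSpace ℝ (Fin n)) :
    depth (a • u) = a * depth u := by
  apply le_antisymm
  · obtain ⟨j, hj⟩ := exists_depth_eq (a • u)
    rw [hj, PiLp.smul_apply, smul_eq_mul, ← mul_neg]
    exact mul_le_mul_of_nonneg_left (neg_le_depth u j) ha
  · obtain ⟨j, hj⟩ := exists_depth_eq u
    rw [hj, mul_neg]
    exact neg_le_depth (a • u) j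

lemma depth_pos {u : EuclideanSpace ℝ (Fin n)} (hu : u ∈ vectorSpan ℝ (range (firm (n := n))))
    (h0 : u ≠ 0) : 0 < depth u := by
  by_contra! hle
  have hnn : ∀ i, 0 ≤ u i := fun i => by linarith [neg_le_depth u i]
  refine h0 (PiLp.ext fun i => ?_)
  exact (Finset.sum_eq_zero_iff_of_nonneg fun i _ => hnn i).1 (sum_eq_zero_of_mem_vectorSpan hu) i
    (Finset.mem_univ i)

lemma mem_vectorSpan_of_sum_eq_zero {u : EuclideanSpace ℝ (Fin n)} (hu : ∑ i, u i = 0) :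
    u ∈ vectorSpan ℝ (range (firm (n := n))) := by
  have : u = ∑ i, u i • (firm (single i) -ᵥ firm (single (0 : Fin n))) := by
    simp only [vsub_eq_sub, smul_sub, Finset.sum_sub_distrib, ← Finset.sum_smul, hu, zero_smul,
      sub_zero, firm_single]
    ext j
    simp [WithLp.ofLp_sum, Finset.sum_apply, Pi.single_apply]
  rw [this]
  exact Submodule.sum_mem _ fun i _ => Submodule.smul_mem _ _
    (vsub_mem_vectorSpan ℝ (mem_range_self _) (mem_range_self _))

/-- The point of the boundary of the standard simplex in the direction `u` from the barycenter. -/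
noncomputable def boundaryPoint (u : EuclideanSpace ℝ (Fin n)) : Fin n → ℝ :=
  fun i => (n : ℝ)⁻¹ + (n * depth u)⁻¹ * u i

lemma boundaryPoint_spec {u : EuclideanSpace ℝ (Fin n)}
    (hu : u ∈ vectorSpan ℝ (range (firm (n := n)))) (h0 : u ≠ 0) :
    (∀ i, 0 ≤ boundaryPoint u i) ∧ ∑ i, boundaryPoint u i = 1 ∧ ∃ j, boundaryPoint u j = 0 := by
  have hn : (0 : ℝ) < n := by exact_mod_cast Nat.pos_of_neZero n
  have hd := depth_pos hu h0
  have heq : ∀ i, boundaryPoint u i = (n * depth u)⁻¹ * (depth u + u i) := fun i => by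
    simp only [boundaryPoint]
    field_simp
  refine ⟨fun i => ?_, ?_, ?_⟩
  · rw [heq]
    have := neg_le_depth u i
    exact mul_nonneg (by positivity) (by linarith)
  · simp only [boundaryPoint, Finset.sum_add_distrib, ← Finset.mul_sum,
      sum_eq_zero_of_mem_vectorSpan hu]
    simp [hn.ne']
  · obtain ⟨j, hj⟩ := exists_depth_eq u
    exact ⟨j, by rw [heq, hj]; simp⟩

lemma continuous_boundaryPoint_dirSphere :
    Continuous fun u : dirSphere (firm (n := n)) => boundaryPoint u.1 := by
  have hn : (n : ℝ) ≠ 0 := by exact_mod_cast NeZero.ne n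
  have hd : Continuous fun u : dirSphere (firm (n := n)) => ((n : ℝ) * depth u.1)⁻¹ :=
    (continuous_const.mul (continuous_depth.comp continuous_subtype_val)).inv₀ fun u =>
      mul_ne_zero hn (depth_pos u.2.1 (dirSphere_ne_zero u)).ne'
  refine continuous_pi fun i => continuous_const.add (hd.mul ?_)
  fun_prop

/-- The sphere of directions is not contractible. -/
theorem not_nullhomotopic_id_dirSphere :
    ¬ (ContinuousMap.id (dirSphere (firm (n := n)))).Nullhomotopic := by
  classical
  rintro ⟨q, ⟨H⟩⟩
  have hn0 : 0 < n := Nat.pos_of_neZero n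
  have hn : (0 : ℝ) < n := by exact_mod_cast hn0
  let X := stdSimplex ℝ (Fin n)
  let w : (Fin n → ℝ) → EuclideanSpace ℝ (Fin n) := fun b => WithLp.toLp 2 b - bary n
  have hwc : Continuous w := by fun_prop
  have hw : ∀ b ∈ X, w b ∈ vectorSpan ℝ (range (firm (n := n))) := fun b hb =>
    mem_vectorSpan_of_sum_eq_zero (by
      simp only [w, PiLp.sub_apply, Finset.sum_sub_distrib, hb.2]
      simp [bary, hn.ne'])
  have hunit : ∀ {b}, b ∈ X → w b ≠ 0 → ‖w b‖⁻¹ • w b ∈ dirSphere (firm (n := n)) :=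
    fun hb h0 => ⟨Submodule.smul_mem _ _ (hw _ hb), by
      rw [norm_smul, norm_inv, norm_norm, inv_mul_cancel₀ (norm_ne_zero_iff.2 h0)]⟩
  let K : X → dirSphere (firm (n := n)) := fun b =>
    if h0 : w b.1 = 0 then q else H (projIcc 0 1 zero_le_one (2 * (1 - n * depth (w b.1))), ⟨_, hunit b.2 h0⟩)
  have hK : Continuous K := by
    rw [continuous_iff_continuousAt]
    intro b
    by_cases h0 : w b.1 = 0
    · have hK0 : K =ᶠ[nhds b] fun _ => q := by
        have hd : ContinuousAt (fun b : X => n * depth (w b.1)) b :=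
          (continuous_const.mul (continuous_depth.comp (hwc.comp
            continuous_subtype_val))).continuousAt
        have hlt : (n : ℝ) * depth (w b.1) < 1 / 2 := by
          obtain ⟨j, hj⟩ := exists_depth_eq (w b.1)
          rw [hj, h0]; simp
        filter_upwards [hd.eventually_lt continuousAt_const hlt] with b' hb'
        by_cases h0' : w b'.1 = 0
        · simp only [K, h0', dif_pos]
        · simp only [K, h0', dif_neg, not_false_eq_true]
          rw [projIcc_of_right_le _ (by linarith)]
          exact H.apply_one _
      exact continuousAt_const.congr hK0.symm
    · have hO : IsOpen {b : X | w b.1 ≠ 0} :=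
        isOpen_ne_fun (hwc.comp continuous_subtype_val) continuous_const
      refine ContinuousOn.continuousAt (s := {b : X | w b.1 ≠ 0}) ?_ (hO.mem_nhds h0)
      rw [continuousOn_iff_continuous_domRestrict]
      have hr : domRestrict {b : X | w b.1 ≠ 0} K = fun b : {b : X | w b.1 ≠ 0} =>
          H (projIcc 0 1 zero_le_one (2 * (1 - n * depth (w b.1.1))), ⟨_, hunit b.1.2 b.2⟩) := by
        funext b
        exact dif_neg b.2
      rw [hr]
      have hwc' : Continuous fun b : {b : X | w b.1 ≠ 0} => w b.1.1 :=
        hwc.comp (continuous_subtype_val.comp continuous_subtype_val)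
      refine H.continuous.comp (Continuous.prodMk (continuous_projIcc.comp ?_) ?_)
      · exact continuous_const.mul (continuous_const.sub (continuous_const.mul
          (continuous_depth.comp hwc')))
      · exact ((hwc'.norm.inv₀ fun b => norm_ne_zero_iff.2 b.2).smul hwc').subtype_mk _
  let h : X → Fin n → ℝ := fun b => boundaryPoint (K b).1
  have hspec := fun b : X => boundaryPoint_spec (K b).2.1 (dirSphere_ne_zero (K b))
  have hext : ∀ b (hb : b ∈ X), Function.extend Subtype.val h 0 b = h ⟨b, hb⟩ := fun b hb =>
    Subtype.val_injective.extend_apply h 0 ⟨b, hb⟩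
  obtain ⟨b, hb, hbar⟩ := exists_eq_barycenter hn0 (Function.extend Subtype.val h 0)
    (by
      rw [continuousOn_iff_continuous_domRestrict]
      exact (continuous_boundaryPoint_dirSphere.comp hK).congr fun b => (hext b.1 b.2).symm)
    (fun b hb => by
      rw [hext b hb]
      exact ⟨(hspec _).1, (hspec _).2.1⟩)
    (fun b hb i hi => by
      rw [hext b hb]
      have hwi : ∀ j, w b j = b j - (n : ℝ)⁻¹ := fun j => rfl
      have h0 : w b ≠ 0 := fun h0 => by
        have := hwi i
        rw [h0, hi] at this
        simp at this
        omega
      have hd : depth (w b) = (n : ℝ)⁻¹ := by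
        apply le_antisymm
        · obtain ⟨j, hj⟩ := exists_depth_eq (w b)
          rw [hj, hwi]
          linarith [hb.1 j]
        · have := neg_le_depth (w b) i
          rw [hwi, hi] at this
          linarith
      have hKb : (K ⟨b, hb⟩).1 = ‖w b‖⁻¹ • w b := by
        simp only [K, h0, dif_neg, not_false_eq_true]
        rw [projIcc_of_le_left _ (by rw [hd, mul_inv_cancel₀ hn.ne']; simp)]
        exact congrArg Subtype.val (H.apply_zero _)
      have hpos : 0 < ‖w b‖ := norm_pos_iff.2 h0
      simp only [h, boundaryPoint, hKb, depth_smul (inv_nonneg.2 hpos.le), hd, PiLp.smul_apply,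
        hwi, hi, smul_eq_mul]
      field_simp
      simp)
  rw [hext b hb] at hbar
  obtain ⟨j, hj⟩ := (hspec ⟨b, hb⟩).2.2
  have := congrFun hbar j
  simp only [h, hj] at this
  exact (inv_pos.2 hn).ne this

end Depth

/-! ### Balanced families and fractional cores -/

lemma isConvexPair_firm_bary {n : ℕ} (hn : 0 < n) : IsConvexPair (firm (n := n)) (bary n) := by
  intro Φ
  constructor
  · rintro ⟨lam, h0, hsum⟩
    have hn' : (0 : ℝ) < n := by exact_mod_cast hn
    have hone : ∑ S ∈ Φ, lam S = 1 := by
      have h1 : ∑ i, (∑ S ∈ Φ, lam S • firm S) i = ∑ S ∈ Φ, lam S := by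
        simp only [WithLp.ofLp_sum, Finset.sum_apply, WithLp.ofLp_smul, Pi.smul_apply]
        rw [Finset.sum_comm]
        simp only [smul_eq_mul, ← Finset.mul_sum, sum_firm, mul_one]
      rw [← h1, hsum]
      simp [bary, hn'.ne']
    rw [IsConvRBalanced, ← hsum]
    exact (convex_convexHull ℝ _).sum_mem h0 hone fun S hS => subset_convexHull _ _ ⟨S, hS, rfl⟩
  · classical
    have hconv : Convex ℝ {x | IsRBalanced (firm (n := n)) x Φ} := by
      rintro x ⟨lx, hx0, hx⟩ y ⟨ly, hy0, hy⟩ a b ha hb -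
      refine ⟨fun S => a * lx S + b * ly S, fun S hS =>
        add_nonneg (mul_nonneg ha (hx0 S hS)) (mul_nonneg hb (hy0 S hS)), ?_⟩
      simp only [add_smul, mul_smul, Finset.sum_add_distrib, ← Finset.smul_sum, hx, hy]
    refine fun h => convexHull_min ?_ hconv h
    rintro _ ⟨S, hS, rfl⟩
    refine ⟨Pi.single S 1, fun T _ => ?_, ?_⟩
    · exact (Pi.single_nonneg (α := fun _ : Coalition n => ℝ) (i := S)).2 zero_le_one T
    · rw [Finset.sum_eq_single_of_mem S hS fun T _ hT => by simp [hT]]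
      simp

lemma isWeights_iff_isBalancingWeights {n : ℕ} (hn : 0 < n) {Φ : Finset (Coalition n)}
    {lam : Coalition n → ℝ} :
    IsWeights firm (bary n) Φ lam ↔ IsBalancingWeights Φ fun S => n * (S.1.card : ℝ)⁻¹ * lam S := by
  have hn' : (0 : ℝ) < n := by exact_mod_cast hn
  have hcard : ∀ S : Coalition n, (0 : ℝ) < (S.1.card : ℝ)⁻¹ := fun S =>
    inv_pos.2 (by exact_mod_cast Finset.card_pos.2 S.2)
  refine and_congr (forall₂_congr fun S _ => ?_) ?_
  · exact (mul_nonneg_iff_of_pos_left (mul_pos hn' (hcard S))).symm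
  · have key : ∀ i, (∑ S ∈ Φ, (n * (S.1.card : ℝ)⁻¹ * lam S) •
        (S.1 : Set (Fin n)).indicator (1 : Fin n → ℝ)) i =
        n * (∑ S ∈ Φ, lam S • firm S : EuclideanSpace ℝ (Fin n)) i := by
      intro i
      simp only [WithLp.ofLp_sum, Finset.sum_apply, WithLp.ofLp_smul, Pi.smul_apply,
        Finset.mul_sum]
      refine Finset.sum_congr rfl fun S _ => ?_
      by_cases hi : i ∈ S.1
      · simp [firm, hi]; ring
      · simp [firm, hi]
    constructor
    · intro h
      ext i
      rw [key, h]
      simp [bary, hn'.ne']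
    · intro h
      ext i
      have := key i
      rw [h] at this
      simp only [bary, Pi.one_apply] at this ⊢
      field_simp
      linarith

lemma fractionalCore_toGen {n : ℕ} (hn : 0 < n) (N : NTUGame n) :
    (N.toGen hn).fractionalCore = N.fractionalCore := by
  have hpos : ∀ S : Coalition n, (0 : ℝ) < n * (S.1.card : ℝ)⁻¹ := fun S =>
    mul_pos (by exact_mod_cast hn) (inv_pos.2 (by exact_mod_cast Finset.card_pos.2 S.2))
  ext x
  refine and_congr ⟨?_, ?_⟩ Iff.rfl
  · rintro ⟨Φ, lam, hw, hx⟩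
    exact ⟨Φ, _, (isWeights_iff_isBalancingWeights hn).1 hw, fun S hS h =>
      hx S hS ((mul_pos_iff_of_pos_left (hpos S)).1 h)⟩
  · rintro ⟨Φ, lam, hw, hx⟩
    refine ⟨Φ, fun S => (n * (S.1.card : ℝ)⁻¹)⁻¹ * lam S,
      (isWeights_iff_isBalancingWeights hn).2 ?_, fun S hS h =>
      hx S hS ((mul_pos_iff_of_pos_left (inv_pos.2 (hpos S))).1 h)⟩
    convert hw using 2 with S
    exact mul_inv_cancel_left₀ (hpos S).ne' _

lemma NTUGame.core_nonempty_of_isBalanced {n : ℕ} (hn : 0 < n) (N : NTUGame n)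
    (hN : N.IsBalanced hn) (h : N.fractionalCore.Nonempty) : (N.core hn).Nonempty := by
  classical
  obtain ⟨x, ⟨Φ, lam, ⟨h0, hsum⟩, hx⟩, hint⟩ := h
  refine ⟨x, hN (Φ.filter fun S => 0 < lam S) ⟨lam, fun S hS => (Finset.mem_filter.1 hS).2.le, ?_⟩
    (mem_iInter₂.2 fun S hS => hx S (Finset.mem_filter.1 hS).1 (Finset.mem_filter.1 hS).2), ?_⟩
  · refine Eq.trans ?_ hsum
    refine Finset.sum_subset (Finset.filter_subset _ _) fun S hS hS' => ?_
    have : lam S = 0 := le_antisymm (not_lt.1 fun h => hS' (Finset.mem_filter.2 ⟨hS, h⟩)) (h0 S hS)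
    rw [this, zero_smul]
  · simpa using hint

lemma fractionalCore_nonempty_of_isRBalanced {ι : Type} [Fintype ι] {n d : ℕ}
    (G : GenGame ι n d) {Φ : Finset ι} (hΦ : IsRBalanced G.v G.r Φ)
    (h : (⋂ i ∈ Φ, G.cover i).Nonempty) : G.fractionalCore.Nonempty := by
  obtain ⟨lam, hlam⟩ := hΦ
  obtain ⟨p, hp⟩ := h
  exact ⟨p + G.tau p • 1, ⟨Φ, lam, hlam, fun i hi _ => mem_iInter₂.1 hp i hi⟩,
    G.add_tau_notMem_interior p⟩

/-! ### Homotopical nontriviality -/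

/-- The cover induced by an NTU game with at least two players is homotopically nontrivial: this is
detected by the boundary of a large simplex. -/
theorem coverNontrivial_toGen_of_two_le {n : ℕ} (hn : 0 < n) (h2 : 2 ≤ n) (N : NTUGame n) :
    (N.toGen hn).CoverNontrivial := by
  have : NeZero n := ⟨hn.ne'⟩
  have hn' : (0 : ℝ) < n := by exact_mod_cast hn
  obtain ⟨M₀, hM₀⟩ := N.exists_forall_lt_zero hn
  obtain ⟨M, hM, hMM⟩ : ∃ M : ℝ, 0 < M ∧ M₀ ≤ M :=
    ⟨max M₀ 1, lt_max_of_lt_right one_pos, le_max_left _ _⟩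
  let D := vectorSpan ℝ (range (firm (n := n)))
  let k := Module.finrank ℝ D
  let A : EuclideanSpace ℝ (Fin k) ≃ₗᵢ[ℝ] D := (stdOrthonormalBasis ℝ D).repr.symm
  have hk : 1 ≤ k := by
    have hne : firm (single (⟨0, hn⟩ : Fin n)) -ᵥ firm (single (⟨1, h2⟩ : Fin n)) ≠ 0 := by
      intro h
      have := congrArg (fun u : EuclideanSpace ℝ (Fin n) => u ⟨0, hn⟩) h
      simp [firm_single] at this
    have : Nontrivial D := ⟨⟨⟨_, vsub_mem_vectorSpan ℝ (mem_range_self _) (mem_range_self _)⟩, 0,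
      fun h => hne (congrArg Subtype.val h)⟩⟩
    exact Module.finrank_pos
  have hAc : Continuous fun y => (A y).1 := continuous_subtype_val.comp A.continuous
  let dir : C(sphere (0 : EuclideanSpace ℝ (Fin k)) 1, dirSphere (firm (n := n))) :=
    ⟨fun y => ⟨(A y.1).1, (A y.1).2, by
      rw [Submodule.norm_coe, A.norm_map]; exact mem_sphere_zero_iff_norm.1 y.2⟩,
      (hAc.comp continuous_subtype_val).subtype_mk _⟩
  let inv : C(dirSphere (firm (n := n)), sphere (0 : EuclideanSpace ℝ (Fin k)) 1) :=
    ⟨fun u => ⟨A.symm ⟨u.1, u.2.1⟩, mem_sphere_zero_iff_norm.2 (by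
      rw [A.symm.norm_map]; exact u.2.2)⟩,
      (A.symm.continuous.comp (continuous_subtype_val.subtype_mk _)).subtype_mk _⟩
  have hdir : ¬ dir.Nullhomotopic := by
    intro h
    have hid : dir.comp inv = ContinuousMap.id _ := by
      ext u : 2
      simp [dir, inv]
    exact not_nullhomotopic_id_dirSphere (hid ▸ h.comp_left inv)
  have hs : ∀ y, -M • boundaryPoint (dir y).1 ∈ boundary n M := fun y => by
    obtain ⟨h1, h2, j, h3⟩ := boundaryPoint_spec (dir y).2.1 (dirSphere_ne_zero (dir y))
    refine (mem_boundary_iff hM).2 ⟨fun i => ?_, ?_, j, by simp [h3]⟩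
    · simpa using mul_nonneg hM.le (h1 i)
    · simp only [Pi.smul_apply, smul_eq_mul, ← Finset.mul_sum, h2, mul_one]
  let s : C(sphere (0 : EuclideanSpace ℝ (Fin k)) 1, boundary n M) :=
    ⟨fun y => ⟨-M • boundaryPoint (dir y).1, hs y⟩,
      ((continuous_boundaryPoint_dirSphere.comp dir.continuous).const_smul (-M)).subtype_mk hs⟩
  have hrad : (radial n M hM).comp s = dir := by
    ext y : 2
    have hd := depth_pos (dir y).2.1 (dirSphere_ne_zero (dir y))
    have hb : bar M (s y).1 - bary n = (n * depth (dir y).1)⁻¹ • (dir y).1 := by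
      ext i
      simp only [bar, bary, s, boundaryPoint, ContinuousMap.coe_mk, PiLp.sub_apply,
        PiLp.smul_apply, Pi.smul_apply, smul_eq_mul]
      field_simp
      ring
    change ‖bar M (s y).1 - bary n‖⁻¹ • (bar M (s y).1 - bary n) = (dir y).1
    rw [hb, norm_smul, (dir y).2.2, smul_smul, mul_one, Real.norm_of_nonneg (by positivity),
      inv_mul_cancel₀ (by positivity), one_smul]
  let den : closedBall (0 : EuclideanSpace ℝ (Fin k)) 1 → ℝ := fun y =>
    n * (depth (A y.1).1 + (1 - ‖y.1‖))
  have hden : ∀ y, den y ≠ 0 := by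
    intro y
    have hy : ‖y.1‖ ≤ 1 := mem_closedBall_zero_iff.1 y.2
    refine mul_ne_zero hn'.ne' ?_
    by_cases h0 : y.1 = 0
    · obtain ⟨j, hj⟩ := exists_depth_eq (A y.1).1
      rw [hj, h0]
      simp
    · have := depth_pos (A y.1).2 fun h => h0 (by simpa using h)
      linarith
  have hdenc : Continuous den := continuous_const.mul
    (((continuous_depth.comp hAc).comp continuous_subtype_val).add
      (continuous_const.sub continuous_subtype_val.norm))
  have hf : ∀ y, ∑ i, ((-M * (den y)⁻¹) • (A y.1).1.ofLp) i = 0 := fun y => by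
    simp only [Pi.smul_apply, smul_eq_mul, ← Finset.mul_sum,
      sum_eq_zero_of_mem_vectorSpan (A y.1).2, mul_zero]
  let f : C(closedBall (0 : EuclideanSpace ℝ (Fin k)) 1, {x : Fin n → ℝ // ∑ i, x i = 0}) :=
    ⟨fun y => ⟨(-M * (den y)⁻¹) • (A y.1).1.ofLp, hf y⟩,
      ((continuous_const.mul (hdenc.inv₀ hden)).smul ((PiLp.continuous_ofLp 2 _).comp
        (hAc.comp continuous_subtype_val))).subtype_mk hf⟩
  have hfs : ∀ y : sphere (0 : EuclideanSpace ℝ (Fin k)) 1,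
      (s y).1 = (f ⟨y, sphere_subset_closedBall y.2⟩).1 + (-M * (n : ℝ)⁻¹) • 1 := by
    intro y
    ext i
    have hy : ‖y.1‖ = 1 := mem_sphere_zero_iff_norm.1 y.2
    simp only [s, f, den, dir, boundaryPoint, ContinuousMap.coe_mk, hy, sub_self, add_zero,
      Pi.smul_apply, Pi.add_apply, smul_eq_mul, Pi.one_apply]
    ring
  have hmem : ∀ (y : sphere (0 : EuclideanSpace ℝ (Fin k)) 1) S,
      (f ⟨y, sphere_subset_closedBall y.2⟩).1 ∈ (N.toGen hn).cover S ↔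
        (s y).1 ∈ (N.toGen hn).cover S := fun y S => by
    rw [hfs, GenGame.add_smul_mem_cover]
  have hneg : ∀ S, ∀ y ∈ {y : sphere (0 : EuclideanSpace ℝ (Fin k)) 1 |
      (f ⟨y, sphere_subset_closedBall y.2⟩).1 ∈ (N.toGen hn).cover S}, ∀ i ∈ S.1,
        (s y).1 i < 0 := by
    intro S y hy
    obtain ⟨h1, h2, -⟩ := (mem_boundary_iff hM).1 (s y).2
    exact hM₀ M hM hMM _ ((mem_simplex_iff hM).2 ⟨h1, h2⟩) S ((hmem y S).1 hy)
  have hcov : ∀ y, ∃ S, y ∈ {y : sphere (0 : EuclideanSpace ℝ (Fin k)) 1 |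
      (f ⟨y, sphere_subset_closedBall y.2⟩).1 ∈ (N.toGen hn).cover S} := fun y =>
    (N.toGen hn).exists_mem_cover _
  obtain ⟨g, hg⟩ := exists_isCoverMap hM s hneg hn
    (fun S => ((N.toGen hn).isClosed_cover S).preimage (by fun_prop)) hcov
  refine ⟨k, f, hk, Or.inr ⟨g, hg, fun hnull => hdir ?_⟩⟩
  have hgd := homotopic_radial_comp hM s hneg hn hcov hg
  rw [hrad] at hgd
  obtain ⟨q, hq⟩ := hnull
  exact ⟨q, hgd.symm.trans hq⟩

/-- With a single player, the hyperplane `H₀` is a point, which lies in the set of the only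
coalition. -/
lemma coverNontrivial_toGen_one (hn : 0 < 1) (N : NTUGame 1) : (N.toGen hn).CoverNontrivial := by
  obtain ⟨S, hS⟩ := (N.toGen hn).exists_mem_cover 0
  refine ⟨1, ContinuousMap.const _ ⟨0, by simp⟩, le_rfl, Or.inl ⟨{S}, ?_, ?_⟩⟩
  · have hSg : S = grand hn := by
      obtain ⟨i, hi⟩ := S.2
      refine Subtype.ext (Finset.eq_univ_of_forall fun j => ?_)
      rwa [Subsingleton.elim j i]
    refine subset_convexHull _ _ ⟨S, by simp, ?_⟩
    rw [hSg]
    exact firm_grand hn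
  · obtain ⟨y, hy⟩ := NormedSpace.sphere_nonempty (E := EuclideanSpace ℝ (Fin 1)) (x := 0) (r := 1)
      |>.2 zero_le_one
    exact ⟨⟨y, hy⟩, by simpa using hS⟩

lemma homotopicallyNontrivial_toGen {n : ℕ} (hn : 0 < n) (N : NTUGame n) :
    (N.toGen hn).HomotopicallyNontrivial := by
  refine ⟨n, N.toGen hn, ⟨fun _ => rfl, fun _ => Iff.rfl⟩, isConvexPair_firm_bary hn, ?_⟩
  rcases Nat.lt_or_ge 1 n with h2 | h1
  · exact coverNontrivial_toGen_of_two_le hn h2 N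
  · obtain rfl : n = 1 := by omega
    exact coverNontrivial_toGen_one hn N

/-! ### The induced cover of the large simplex -/

section Simplex

variable {n : ℕ} (hn : 0 < n) (N : NTUGame n) {M : ℝ} (hM : 0 < M)
  (hneg : ∀ p ∈ simplex n M, ∀ S, p ∈ (N.toGen hn).cover S → ∀ i ∈ S.1, p i < 0)

include hM hneg in
lemma isKKMSCover_cover : IsKKMSCover M (N.toGen hn).cover := by
  have : NeZero n := ⟨hn.ne'⟩
  refine ⟨fun S => ((N.toGen hn).isClosed_cover S).inter ?_, fun T p hp => ?_⟩
  · exact ((Set.toFinite _).isCompact_convexHull ℝ).isClosed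
  · obtain ⟨h1, h2, h3⟩ := (mem_face_iff hM).1 hp
    obtain ⟨S, hS⟩ := (N.toGen hn).exists_mem_cover p
    refine mem_iUnion.2 ⟨⟨S, fun i hi => ?_⟩, hS⟩
    by_contra hiT
    exact (hneg p ((mem_simplex_iff hM).2 ⟨h1, h2⟩) S hS i hi).ne (h3 i hiT)

include hneg in
lemma hasCoverDegree_boundary (m : ℕ) : HasCoverDegree
    (fun S : Coalition n => {p : boundary n M | (p : Fin n → ℝ) ∈ (N.toGen hn).cover S})
    (N.toGen hn).v (N.toGen hn).r (radial n M hM) m 1 := by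
  have : NeZero n := ⟨hn.ne'⟩
  have : CompactSpace (boundary n M) := isCompact_iff_compactSpace.1
    (isCompact_iUnion fun T => (Set.toFinite _).isCompact_convexHull ℝ)
  have hneg' : ∀ S, ∀ p ∈ {p : boundary n M | (p : Fin n → ℝ) ∈ (N.toGen hn).cover S}, ∀ i ∈ S.1,
      (ContinuousMap.id (boundary n M) p).1 i < 0 := by
    intro S p hp
    obtain ⟨h1, h2, -⟩ := (mem_boundary_iff hM).1 p.2
    exact hneg p ((mem_simplex_iff hM).2 ⟨h1, h2⟩) S hp
  have hcov : ∀ p, ∃ S, p ∈ {p : boundary n M | (p : Fin n → ℝ) ∈ (N.toGen hn).cover S} :=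
    fun p => (N.toGen hn).exists_mem_cover p
  refine ⟨not_hasBalancedIntersection hM _ hneg', exists_isCoverMap hM _ hneg' hn
    (fun S => ((N.toGen hn).isClosed_cover S).preimage continuous_subtype_val) hcov,
    fun g hg z _ => ?_⟩
  rw [one_smul]
  have := homotopic_radial_comp hM _ hneg' hn hcov hg
  rw [ContinuousMap.comp_id] at this
  exact DFunLike.congr_fun (homologyMap_eq_of_homotopic m this) z

end Simplex

end ScarfGame

open ScarfGame in
theorem mainTheorem8 (n : ℕ) (hn : 0 < n) (N : NTUGame n) :
    (∃ M₀ : ℝ, ∀ (M : ℝ) (hM : 0 < M), M₀ ≤ M →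
      IsKKMSCover M (N.toGen hn).cover ∧
      (2 ≤ n → HasCoverDegree
        (fun S : Coalition n => {p : boundary n M | (p : Fin n → ℝ) ∈ (N.toGen hn).cover S})
        (N.toGen hn).v (N.toGen hn).r (radial n M hM) (n - 2) 1) ∧
      ∃ S : Finset (Coalition n), IsRBalanced (N.toGen hn).v (N.toGen hn).r S ∧
        (simplex n M ∩ ⋂ T ∈ S, (N.toGen hn).cover T).Nonempty) ∧
    IsConvexPair (N.toGen hn).v (N.toGen hn).r ∧
    (N.toGen hn).HomotopicallyNontrivial ∧
    (N.toGen hn).fractionalCore.Nonempty ∧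
    (N.toGen hn).fractionalCore = N.fractionalCore ∧
    (N.IsBalanced hn → (N.core hn).Nonempty) := by
  have : NeZero n := ⟨hn.ne'⟩
  obtain ⟨M₀, hM₀⟩ := N.exists_forall_lt_zero hn
  have hbal : ∀ M : ℝ, 0 < M → M₀ ≤ M → ∃ S : Finset (Coalition n),
      IsRBalanced (N.toGen hn).v (N.toGen hn).r S ∧
        (simplex n M ∩ ⋂ T ∈ S, (N.toGen hn).cover T).Nonempty := by
    intro M hM hMM
    obtain ⟨Φ, hΦ, hne⟩ := exists_isConvRBalanced_simplex_inter_nonempty hn hM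
      (N.toGen hn).isClosed_cover (N.toGen hn).exists_mem_cover (hM₀ M hM hMM)
    exact ⟨Φ, (isConvexPair_firm_bary hn Φ).2 hΦ, hne⟩
  have hcore : (N.toGen hn).fractionalCore.Nonempty := by
    obtain ⟨Φ, hΦ, hne⟩ := hbal (max M₀ 1) (lt_max_of_lt_right one_pos) (le_max_left _ _)
    exact fractionalCore_nonempty_of_isRBalanced _ hΦ (hne.mono inter_subset_right)
  have heq := fractionalCore_toGen hn N
  exact ⟨⟨M₀, fun M hM hMM => ⟨isKKMSCover_cover hn N hM (hM₀ M hM hMM),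
    fun _ => hasCoverDegree_boundary hn N hM (hM₀ M hM hMM) (n - 2), hbal M hM hMM⟩⟩,
    isConvexPair_firm_bary hn, homotopicallyNontrivial_toGen hn N, hcore, heq,
    fun hN => N.core_nonempty_of_isBalanced hn hN (heq ▸ hcore)⟩
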